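/- Let $T^2=\mathbb R^2/\mathbb Z^2$, let $g_0$ be a smooth Riemannian metric on $T^2$ that is flat (its Gaussian curvature vanishes identically), and let $g=e^{2u}g_0$ be a smooth Riemannian metric on $T^2$ conformal to $g_0$, where $u:T^2\to\mathbb R$. For a smooth Riemannian metric $h$ on $T^2$ let $K_h$ denote its Gaussian curvature and put $$\mathcal K_1(T^2,h)=\int_{T^2}|K_h|\,d\mathrm{area}_h,\qquad \mathcal V(T^2,h)=\frac{\mathrm{area}(T^2,h)}{\mathrm{sys}_1(T^2,h)^2},$$ where $\mathrm{sys}_1(T^2,h)$ is the length with respect to $h$ of the shortest non-contractible loop in $T^2$, that is, the infimum of the lengths of the non-contractible $C^1$ loops. Let $c_1,c_2:S^1\to T^2$ be continuous closed paths, neither of which is homologous to zero in $H_1(T^2;\mathbb Z)$, and set $$v_1=\max_{t\in S^1}u(c_1(t)),\qquad v_2=\min_{t\in S^1}u(c_2(t)).$$ Then both of the following inequalities hold: $$\text{(a)}\quad v_2-v_1\le\frac{\mathcal K_1(T^2,g)\,\mathcal V(T^2,g_0)}{8},\qquad\qquad \text{(b)}\quad v_2-v_1\le\frac{\mathcal K_1(T^2,g)\,\mathcal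 V(T^2,g)}{8}.$$ -/

import Mathlib

open Matrix MeasureTheory Set
open scoped ContDiff

noncomputable section

namespace RiemannTorus

/-- The two-dimensional torus `T² = ℝ²/ℤ²`. -/
abbrev Torus : Type := UnitAddTorus (Fin 2)

/-- The universal covering `ℝ² → T²`. -/
def proj (x : Fin 2 → ℝ) : Torus := fun i => (x i : UnitAddCircle)

/-- A smooth Riemannian metric on `T²`, given by its Gram matrix in the global frame `∂₀, ∂₁`
of coordinate vector fields; smoothness is read on the universal covering. -/
structure Metric where
  gram : Torus → Matrix (Fin 2) (Fin 2) ℝ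
  posDef : ∀ p, (gram p).PosDef
  smooth : ∀ i j, ContDiff ℝ ∞ (fun x : Fin 2 → ℝ => gram (proj x) i j)

/-- The coordinate derivative `∂ᵢ f` of a function on `T²`. -/
def pderiv (i : Fin 2) (f : Torus → ℝ) (p : Torus) : ℝ :=
  deriv (fun t : ℝ => f (p + Pi.single i (t : UnitAddCircle))) 0

namespace Metric

/-- Christoffel symbols `Γᵏᵢⱼ` of the Levi-Civita connection. -/
def christoffel (g : Metric) (k i j : Fin 2) (p : Torus) : ℝ :=
  (1 / 2) * ∑ l, (g.gram p)⁻¹ k l *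
    (pderiv i (fun q => g.gram q j l) p + pderiv j (fun q => g.gram q i l) p
      - pderiv l (fun q => g.gram q i j) p)

/-- Components of the curvature tensor: `R(∂ᵢ, ∂ⱼ) ∂ₖ = ∑ₗ (riemann g l i j k) ∂ₗ`, where
`R(X, Y) = ∇_X ∇_Y - ∇_Y ∇_X - ∇_[X, Y]`. -/
def riemann (g : Metric) (l i j k : Fin 2) (p : Torus) : ℝ :=
  pderiv i (g.christoffel l j k) p - pderiv j (g.christoffel l i k) p
    + ∑ m, (g.christoffel m j k p * g.christoffel l i m p
      - g.christoffel m i k p * g.christoffel l j m p)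

/-- The Gaussian curvature `K_g = g(R(∂₀, ∂₁) ∂₁, ∂₀) / det g`. -/
def gaussCurvature (g : Metric) (p : Torus) : ℝ :=
  (∑ l, g.gram p l 0 * g.riemann l 0 1 1 p) / (g.gram p).det

/-- A metric is flat if its Gaussian curvature vanishes identically. -/
def IsFlat (g : Metric) : Prop := ∀ p, g.gaussCurvature p = 0

/-- The integral of `f` over `T²` against the Riemannian area element of `g`. -/
def areaIntegral (g : Metric) (f : Torus → ℝ) : ℝ :=
  ∫ p : Torus, f p * Real.sqrt (g.gram p).det

/-- The total area of `(T², g)`. -/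
def area (g : Metric) : ℝ := g.areaIntegral (fun _ => 1)

/-- `𝒦_p(T², g) = ‖K_g‖_{L^p(T², g)} · area(T², g)^(1 - 1/p)`. -/
def curvatureNorm (g : Metric) (p : ℝ) : ℝ :=
  (g.areaIntegral (fun x => |g.gaussCurvature x| ^ p)) ^ (1 / p) * g.area ^ (1 - 1 / p)

/-- The `g`-length over one period of the closed curve in `T²` parametrized by `proj ∘ γ`. -/
def length (g : Metric) (γ : ℝ → Fin 2 → ℝ) : ℝ :=
  ∫ t in (0 : ℝ)..1,
    Real.sqrt (deriv γ t ⬝ᵥ (g.gram (proj (γ t)) *ᵥ deriv γ t))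

/-- The 1-systole: the infimum of the lengths of the non-contractible `C¹` loops `c : S¹ → T²`.
The lengths are computed through a `C¹` lift `γ : ℝ → ℝ²` of `t ↦ c t`. -/
def systole (g : Metric) : ℝ :=
  sInf {L : ℝ | ∃ (c : C(UnitAddCircle, Torus)) (γ : ℝ → Fin 2 → ℝ),
    ¬ c.Nullhomotopic ∧ ContDiff ℝ 1 γ ∧ (∀ t : ℝ, proj (γ t) = c (t : UnitAddCircle)) ∧
      L = g.length γ}

/-- `𝒱(T², g) = area(T², g) / sys₁(T², g)²`. -/
def systolicVolume (g : Metric) : ℝ := g.area / g.systole ^ 2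

end Metric

/-- A closed path `c : S¹ → T²` is homologous to zero if it induces the zero map
`H₁(S¹; ℤ) → H₁(T²; ℤ)` on singular homology, equivalently if it sends the fundamental class
generating `H₁(S¹; ℤ)` to zero. -/
def NullHomologous (c : C(UnitAddCircle, Torus)) : Prop :=
  ((AlgebraicTopology.singularHomologyFunctor (ModuleCat.{0} ℤ) 1).obj (ModuleCat.of ℤ ℤ)).map
    (TopCat.ofHom c) = 0

end RiemannTorus

end

/-!
The proof works on the universal covering.

*Flat coordinates.* The Levi-Civita connection form of a flat metric in an orthonormal coframe is
closed; integrating it and rotating the coframe accordingly gives a closed coframe, which integrates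
to a developing map. Its holonomy consists of translations that span the plane, because
it is open and the torus compact (`Metric.IsDeveloping.exists_translations`). After a linear change of coordinates it is
therefore a `ℤ²`-equivariant, hence proper, local diffeomorphism of the plane, that is, a global
chart `Φ` in which `g₀` has a constant Gram matrix `Q` and `ℤ²` acts by integral translations
(`Metric.IsFlat.exists_flatChart`).

*Reduction to parallel curves.* Assume `v₁ < v₂`. Then the curves `c₁` and `c₂` are disjoint. Two
closed paths whose displacements in `ℤ²` are linearly independent intersect
(`exists_intersection_of_equivariant`, by a winding number argument), so the
displacements are proportional. They are nonzero, because a path with zero displacement is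
null-homotopic. By Bézout the chart may be chosen with both displacements on the first axis.

*Upper bound for the energy.* For `g = e^{2u} g₀` with `g₀` flat, `K_g dA_g = -Δ₀u dA₀`. For a `C¹`
truncation `χ` of `u` between `v₁` and `v₂`, of oscillation `δ`, integrating by parts
`∫ χ'(u) |∇u|² = ∫ (χ(u) - δ/2) (-Δ₀u)` bounds the energy by `(δ/2) ∫ |K_g| dA_g`
(`Metric.IsConformal.squareIntegral_energyDensity_le`).

*Lower bound for the energy.* In the chart, every line orthogonal to the first axis meets the
translates of the lifts of the two curves alternately, two per unit of height, so that `χ(u)` goes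
up and down by `δ` on average once per unit of height. Averaging over these lines bounds the
integral of the orthogonal derivative of `χ(u)` below by `2δ` (`two_mul_sub_le_squareIntegral`), and
Cauchy–Schwarz then gives `8 Q₀₀ (v₂ - v₁) ≤ √(det Q) ∫ |K_g| dA_g` (`FlatChart.oscillation_le`).

*The systole.* The lines parallel to the first axis are closed and not contractible. Averaging their
`g`-lengths and applying Cauchy–Schwarz gives `sys(g)² √(det Q) ≤ Q₀₀ area(g)`
(`FlatChart.sq_systole_mul_le`) for every `g` conformal to `g₀`, including `g₀` itself. Combined
with the previous bound and `0 < sys(g)` (`Metric.systole_pos`), this is the claim for both metrics.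
-/

noncomputable section

namespace RiemannTorus

/-! ### Crossing of curves in the plane -/

/-- Brouwer's theorem in the form used here: if `H` had no zero it would have a continuous
logarithm on the plane, whereas on a large circle `H` winds once around the origin. -/
theorem exists_eq_zero_of_norm_sub_self_le {H : ℂ → ℂ} (hH : Continuous H) {B : ℝ}
    (hB : ∀ z, ‖H z - z‖ ≤ B) : ∃ z, H z = 0 := by
  by_contra! h0
  obtain ⟨G, ⟨-, hG⟩, -⟩ := Complex.isCoveringMapOn_exp.existsUnique_continuousMap_lifts
    (⟨H, hH⟩ : C(ℂ, ℂ)) (a₀ := 0) (e₀ := Complex.log (H 0)) (Complex.exp_log (h0 0)) (fun a ↦ h0 a)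
  replace hG : ∀ z, Complex.exp (G z) = H z := fun z ↦ congrFun hG z
  have hB0 : 0 ≤ B := (norm_nonneg _).trans (hB 0)
  set R : ℝ := B + 1
  have hR : 0 < R := by positivity
  let c : ℝ → ℂ := fun θ ↦ R * Complex.exp (θ * Complex.I)
  have hcc : Continuous c := by fun_prop
  have hcn : ∀ θ, ‖c θ‖ = R := fun θ ↦ by
    simp [c, Complex.norm_exp_ofReal_mul_I, abs_of_pos hR]
  have hc0 : ∀ θ, c θ ≠ 0 := fun θ h ↦ by
    have := hcn θ
    rw [h, norm_zero] at this
    exact hR.ne this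
  have hslit : ∀ θ, H (c θ) / c θ ∈ Complex.slitPlane := by
    intro θ
    have : H (c θ) / c θ = 1 + (H (c θ) - c θ) / c θ := by
      field_simp [hc0 θ]
      ring
    rw [this]
    apply Complex.mem_slitPlane_of_norm_lt_one
    rw [norm_div, hcn, div_lt_one hR]
    exact (hB _).trans_lt (lt_add_one B)
  let φ : ℝ → ℂ := fun θ ↦ G (c θ) - Complex.log (H (c θ) / c θ) - θ * Complex.I
  have hφc : Continuous φ := by
    refine ((G.continuous.comp hcc).sub ?_).sub (by fun_prop)
    exact Continuous.clog ((hH.comp hcc).div hcc hc0) hslit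
  have hφ : ∀ θ, Complex.exp (φ θ) = R := by
    intro θ
    simp only [φ]
    rw [Complex.exp_sub, Complex.exp_sub, hG, Complex.exp_log (div_ne_zero (h0 _) (hc0 _)),
      div_div_cancel₀ (h0 _)]
    simp [c]
  have hconst := Complex.isCoveringMap_exp.const_of_comp hφc
    (fun a b ↦ Subtype.ext ((hφ a).trans (hφ b).symm)) (2 * Real.pi) 0
  have hc2 : c (2 * Real.pi) = c 0 := by simp [c]
  simp only [φ, hc2] at hconst
  simpa [Real.pi_ne_zero] using sub_right_injective hconst

/-- A continuous self-map of the plane at bounded distance from an invertible linear map has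
a zero. -/
theorem exists_eq_zero_of_linear_add_bounded {p q : ℝ → ℝ → ℝ}
    (hp : Continuous (fun z : ℝ × ℝ ↦ p z.1 z.2)) (hq : Continuous (fun z : ℝ × ℝ ↦ q z.1 z.2))
    {α β γ δ B : ℝ} (hdet : α * δ - β * γ ≠ 0)
    (hpB : ∀ s t, |p s t - (α * s + β * t)| ≤ B) (hqB : ∀ s t, |q s t - (γ * s + δ * t)| ≤ B) :
    ∃ s t, p s t = 0 ∧ q s t = 0 := by
  set D := α * δ - β * γ with hD
  let s : ℂ → ℝ := fun z ↦ (δ * z.re - β * z.im) / D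
  let t : ℂ → ℝ := fun z ↦ (α * z.im - γ * z.re) / D
  have hs : Continuous s := by fun_prop
  have ht : Continuous t := by fun_prop
  let H : ℂ → ℂ := fun z ↦ (p (s z) (t z) : ℂ) + (q (s z) (t z) : ℂ) * Complex.I
  have hH : Continuous H := by
    have h1 : Continuous fun z ↦ p (s z) (t z) := hp.comp (hs.prodMk ht)
    have h2 : Continuous fun z ↦ q (s z) (t z) := hq.comp (hs.prodMk ht)
    fun_prop
  obtain ⟨z, hz⟩ := exists_eq_zero_of_norm_sub_self_le (B := B + B) hH (fun z ↦ by
    refine (Complex.norm_le_abs_re_add_abs_im _).trans (add_le_add ?_ ?_)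
    · have h1 : α * s z + β * t z = z.re := by
        simp only [s, t]; field_simp; ring
      have := hpB (s z) (t z)
      rw [h1] at this
      simpa [H] using this
    · have h1 : γ * s z + δ * t z = z.im := by
        simp only [s, t]; field_simp; ring
      have := hqB (s z) (t z)
      rw [h1] at this
      simpa [H] using this)
  refine ⟨s z, t z, ?_, ?_⟩
  · simpa [H] using congrArg Complex.re hz
  · simpa [H] using congrArg Complex.im hz

theorem exists_abs_le_of_continuous_of_periodic {g : ℝ → ℝ} (hg : Continuous g)
    (hp : ∀ s, g (s + 1) = g s) : ∃ M, 0 ≤ M ∧ ∀ s, |g s| ≤ M := by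
  have hper : Function.Periodic g 1 := hp
  obtain ⟨M, hM⟩ := (hper.isBounded_of_continuous one_ne_zero hg).exists_norm_le
  exact ⟨M, (norm_nonneg _).trans (hM _ (mem_range_self 0)), fun s ↦ hM _ (mem_range_self s)⟩

theorem exists_abs_sub_mul_le {g : ℝ → ℝ} (hg : Continuous g) {k : ℝ}
    (hp : ∀ s, g (s + 1) = g s + k) : ∃ M, 0 ≤ M ∧ ∀ s, |g s - k * s| ≤ M :=
  exists_abs_le_of_continuous_of_periodic (g := fun s ↦ g s - k * s) (by fun_prop)
    (fun s ↦ by simp only [hp]; ring)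

/-- Two curves in the plane that are equivariant under translations by linearly independent
vectors `(m₀, m₁)` and `(n₀, n₁)` intersect. -/
theorem exists_intersection_of_equivariant {Y Z : ℝ → Fin 2 → ℝ} (hY : Continuous Y)
    (hZ : Continuous Z) {m n : Fin 2 → ℝ} (hm : ∀ s, Y (s + 1) = Y s + m)
    (hn : ∀ s, Z (s + 1) = Z s + n) (hdet : m 0 * n 1 - m 1 * n 0 ≠ 0) :
    ∃ s t, Y s = Z t := by
  have hYi : ∀ i, Continuous fun s ↦ Y s i := fun i ↦ (continuous_apply i).comp hY
  have hZi : ∀ i, Continuous fun s ↦ Z s i := fun i ↦ (continuous_apply i).comp hZ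
  have key : ∀ i, ∃ B, ∀ s t, |(Y s i - Z t i) - (m i * s + (-n i) * t)| ≤ B := by
    intro i
    obtain ⟨B, -, hB⟩ := exists_abs_sub_mul_le (hYi i) (k := m i) (fun s ↦ by simp [hm])
    obtain ⟨B', -, hB'⟩ := exists_abs_sub_mul_le (hZi i) (k := n i) (fun s ↦ by simp [hn])
    refine ⟨B + B', fun s t ↦ ?_⟩
    have : (Y s i - Z t i) - (m i * s + (-n i) * t) = (Y s i - m i * s) - (Z t i - n i * t) := by
      ring
    rw [this]
    exact (abs_sub _ _).trans (add_le_add (hB s) (hB' t))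
  obtain ⟨B₀, h₀⟩ := key 0
  obtain ⟨B₁, h₁⟩ := key 1
  obtain ⟨s, t, h0, h1⟩ := exists_eq_zero_of_linear_add_bounded
    (p := fun s t ↦ Y s 0 - Z t 0) (q := fun s t ↦ Y s 1 - Z t 1)
    (((hYi 0).comp continuous_fst).sub ((hZi 0).comp continuous_snd))
    (((hYi 1).comp continuous_fst).sub ((hZi 1).comp continuous_snd))
    (α := m 0) (β := -n 0) (γ := m 1) (δ := -n 1) (B := max B₀ B₁)
    (by contrapose! hdet; linarith)
    (fun s t ↦ (h₀ s t).trans (le_max_left _ _)) (fun s t ↦ (h₁ s t).trans (le_max_right _ _))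
  refine ⟨s, t, funext fun i ↦ ?_⟩
  fin_cases i
  · exact sub_eq_zero.1 h0
  · exact sub_eq_zero.1 h1

/-- A curve `s ↦ (ξ s, η s)` in the plane that is invariant under a nonzero horizontal
translation. It separates the plane, and meets every vertical line. -/
structure HorizontalCurve where
  ξ : ℝ → ℝ
  η : ℝ → ℝ
  k : ℝ
  continuous_ξ : Continuous ξ
  continuous_η : Continuous η
  ξ_add_one : ∀ s, ξ (s + 1) = ξ s + k
  η_add_one : ∀ s, η (s + 1) = η s
  k_ne_zero : k ≠ 0

namespace HorizontalCurve

variable (C : HorizontalCurve)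

theorem exists_crossing {a b : ℝ → ℝ} (ha : Continuous a) (hb : Continuous b) {M N : ℝ}
    (haM : ∀ t, |a t| ≤ M) (hbN : ∀ t, |b t - t| ≤ N) : ∃ s t, C.ξ s = a t ∧ C.η s = b t := by
  obtain ⟨B, -, hB⟩ := exists_abs_sub_mul_le C.continuous_ξ C.ξ_add_one
  obtain ⟨B', -, hB'⟩ := exists_abs_le_of_continuous_of_periodic C.continuous_η C.η_add_one
  obtain ⟨s, t, h0, h1⟩ := exists_eq_zero_of_linear_add_bounded
    (p := fun s t ↦ C.ξ s - a t) (q := fun s t ↦ C.η s - b t)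
    ((C.continuous_ξ.comp continuous_fst).sub (ha.comp continuous_snd))
    ((C.continuous_η.comp continuous_fst).sub (hb.comp continuous_snd))
    (α := C.k) (β := 0) (γ := 0) (δ := -1) (B := max (B + M) (B' + N))
    (by simpa using C.k_ne_zero)
    (fun s t ↦ by
      have : C.ξ s - a t - (C.k * s + 0 * t) = (C.ξ s - C.k * s) - a t := by ring
      rw [this]
      exact ((abs_sub _ _).trans (add_le_add (hB s) (haM t))).trans (le_max_left _ _))
    (fun s t ↦ by
      have : C.η s - b t - (0 * s + -1 * t) = C.η s - (b t - t) := by ring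
      rw [this]
      exact ((abs_sub _ _).trans (add_le_add (hB' s) (hbN t))).trans (le_max_right _ _))
  exact ⟨s, t, sub_eq_zero.1 h0, sub_eq_zero.1 h1⟩

theorem slice_nonempty (x : ℝ) : {s | C.ξ s = x}.Nonempty := by
  obtain ⟨s, t, h, -⟩ := C.exists_crossing (a := fun _ ↦ x) (b := fun t ↦ t) (by fun_prop)
    (by fun_prop) (M := |x|) (N := 0) (by simp) (by simp)
  exact ⟨s, h⟩

theorem isCompact_slice (x : ℝ) : IsCompact {s | C.ξ s = x} := by
  obtain ⟨B, -, hB⟩ := exists_abs_sub_mul_le C.continuous_ξ C.ξ_add_one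
  refine Metric.isCompact_of_isClosed_isBounded (isClosed_eq C.continuous_ξ continuous_const) ?_
  refine (Metric.isBounded_closedBall (x := x / C.k) (r := B / |C.k|)).subset fun s hs ↦ ?_
  have hk := C.k_ne_zero
  have h := hB s
  rw [show C.ξ s = x from hs] at h
  rw [Metric.mem_closedBall, Real.dist_eq, le_div_iff₀ (abs_pos.2 hk), ← abs_mul]
  have : (s - x / C.k) * C.k = -(x - C.k * s) := by field_simp; ring
  rwa [this, abs_neg]

/-- The height of the highest point of the curve on the vertical line at abscissa `x`. -/
def top (x : ℝ) : ℝ := sSup (C.η '' {s | C.ξ s = x})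

/-- The height of the lowest point of the curve on the vertical line at abscissa `x`. -/
def bottom (x : ℝ) : ℝ := sInf (C.η '' {s | C.ξ s = x})

theorem isCompact_image_slice (x : ℝ) : IsCompact (C.η '' {s | C.ξ s = x}) :=
  (C.isCompact_slice x).image C.continuous_η

theorem exists_eq_top (x : ℝ) : ∃ s, C.ξ s = x ∧ C.η s = C.top x :=
  (C.isCompact_image_slice x).sSup_mem ((C.slice_nonempty x).image _)

theorem exists_eq_bottom (x : ℝ) : ∃ s, C.ξ s = x ∧ C.η s = C.bottom x :=
  (C.isCompact_image_slice x).sInf_mem ((C.slice_nonempty x).image _)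

theorem le_top {s x : ℝ} (h : C.ξ s = x) : C.η s ≤ C.top x :=
  le_csSup (C.isCompact_image_slice x).bddAbove (mem_image_of_mem _ h)

theorem bottom_le {s x : ℝ} (h : C.ξ s = x) : C.bottom x ≤ C.η s :=
  csInf_le (C.isCompact_image_slice x).bddBelow (mem_image_of_mem _ h)

/-- The translate of a horizontal curve by the vector `(a, b)`. -/
def shift (a b : ℝ) : HorizontalCurve where
  ξ s := C.ξ s + a
  η s := C.η s + b
  k := C.k
  continuous_ξ := C.continuous_ξ.add continuous_const
  continuous_η := C.continuous_η.add continuous_const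
  ξ_add_one s := by rw [C.ξ_add_one]; ring
  η_add_one s := by rw [C.η_add_one]
  k_ne_zero := C.k_ne_zero

theorem top_shift (a b x : ℝ) : (C.shift a b).top x = C.top (x - a) + b := by
  apply le_antisymm
  · obtain ⟨s, hs, hs'⟩ := (C.shift a b).exists_eq_top x
    rw [← hs']
    have := C.le_top (s := s) (x := x - a) (by rw [← hs]; simp [shift])
    simpa [shift] using this
  · obtain ⟨s, hs, hs'⟩ := C.exists_eq_top (x - a)
    rw [← hs']
    exact (C.shift a b).le_top (s := s) (by simp [shift, hs])

variable {C} {C' : HorizontalCurve}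

/-- If `C` reaches some vertical line from below before `C'` does, then every vertical line
leaves `C'` after having left `C`: otherwise one could come from `-∞` up to `C`, follow `C`, and
leave upwards from its highest point without ever meeting `C'`. -/
theorem top_lt_top_of_bottom_lt_bottom (hd : ∀ s t, C.ξ s = C'.ξ t → C.η s ≠ C'.η t) {x₀ : ℝ}
    (h : C.bottom x₀ < C'.bottom x₀) (x : ℝ) : C.top x < C'.top x := by
  by_contra! hle
  obtain ⟨s₀, hs₀, hs₀'⟩ := C.exists_eq_bottom x₀
  obtain ⟨s₁, hs₁, hs₁'⟩ := C.exists_eq_top x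
  let c : ℝ → ℝ := fun t ↦ max 0 (min t 1)
  have hc : Continuous c := by fun_prop
  have hc01 : ∀ t, c t ∈ Icc (0 : ℝ) 1 := fun t ↦ ⟨le_max_left _ _, by simp [c]⟩
  let r : ℝ → ℝ := fun t ↦ s₀ + c t * (s₁ - s₀)
  have hr : Continuous r := by fun_prop
  have hbd : ∀ g : ℝ → ℝ, Continuous g → ∃ M, ∀ t, |g (r t)| ≤ M := by
    intro g hg
    obtain ⟨M, hM⟩ := isCompact_Icc.exists_bound_of_continuousOn (s := Icc (0 : ℝ) 1)
      (f := fun u ↦ g (s₀ + u * (s₁ - s₀))) (by fun_prop)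
    exact ⟨M, fun t ↦ hM _ (hc01 t)⟩
  obtain ⟨M, hM⟩ := hbd C.ξ C.continuous_ξ
  obtain ⟨N, hN⟩ := hbd C.η C.continuous_η
  obtain ⟨s, t, h1, h2⟩ := C'.exists_crossing (a := fun t ↦ C.ξ (r t))
    (b := fun t ↦ C.η (r t) + (min t 0 + max (t - 1) 0)) (M := M) (N := N + 1)
    (C.continuous_ξ.comp hr) ((C.continuous_η.comp hr).add (by fun_prop)) hM (fun t ↦ by
      have : C.η (r t) + (min t 0 + max (t - 1) 0) - t = C.η (r t) - c t := by
        simp only [c]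
        rcases le_total t 0 with h0 | h0
        · rw [min_eq_left h0, max_eq_right (by linarith), min_eq_left (by linarith), max_eq_left h0]
          ring
        · rcases le_total t 1 with h1 | h1
          · rw [min_eq_right h0, max_eq_right (by linarith), min_eq_left (by linarith),
              max_eq_right h0]
            ring
          · rw [min_eq_right h0, max_eq_left (by linarith), min_eq_right (by linarith),
              max_eq_right zero_le_one]
            ring
      rw [this]
      refine (abs_sub _ _).trans (add_le_add (hN t) ?_)
      rw [abs_of_nonneg (hc01 t).1]
      exact (hc01 t).2)
  rcases lt_or_ge t 0 with ht | ht
  · have hrt : r t = s₀ := by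
      simp [r, c, min_eq_left (show t ≤ 1 by linarith), max_eq_left ht.le]
    rw [hrt, hs₀'] at h2
    rw [hrt, hs₀] at h1
    rw [min_eq_left ht.le, max_eq_right (by linarith)] at h2
    have := C'.bottom_le h1
    linarith
  · rcases le_or_gt t 1 with ht1 | ht1
    · rw [min_eq_right ht, max_eq_right (by linarith)] at h2
      exact hd (r t) s h1.symm (by linarith)
    · have hrt : r t = s₁ := by
        simp [r, c, min_eq_right ht1.le]
      rw [hrt, hs₁'] at h2
      rw [hrt, hs₁] at h1
      rw [min_eq_right ht, max_eq_left (by linarith)] at h2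
      have := C'.le_top h1
      linarith

/-- Of two disjoint horizontal curves, one lies below the other, in the sense that every vertical
line leaves it earlier. -/
theorem top_lt_top_or (hd : ∀ s t, C.ξ s = C'.ξ t → C.η s ≠ C'.η t) :
    (∀ x, C.top x < C'.top x) ∨ ∀ x, C'.top x < C.top x := by
  rcases lt_trichotomy (C.bottom 0) (C'.bottom 0) with h | h | h
  · exact .inl (top_lt_top_of_bottom_lt_bottom hd h)
  · obtain ⟨s, hs, hs'⟩ := C.exists_eq_bottom 0
    obtain ⟨t, ht, ht'⟩ := C'.exists_eq_bottom 0
    exact (hd s t (hs.trans ht.symm) (by rw [hs', ht', h])).elim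
  · exact .inr (top_lt_top_of_bottom_lt_bottom (fun s t h1 h2 ↦ hd t s h1.symm h2.symm) h)

theorem exists_abs_top_le (C : HorizontalCurve) : ∃ M, ∀ x, |C.top x| ≤ M := by
  obtain ⟨M, -, hM⟩ := exists_abs_le_of_continuous_of_periodic C.continuous_η C.η_add_one
  refine ⟨M, fun x ↦ ?_⟩
  obtain ⟨s, -, hs⟩ := C.exists_eq_top x
  rw [← hs]
  exact hM s

/-- If a horizontal curve `A` is disjoint from all translates of `B` by multiples of `(σ, 1)`,
then it lies between two consecutive ones. -/
theorem exists_between_shifts {A B : HorizontalCurve} {σ : ℝ}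
    (hd : ∀ (n : ℤ) s t, A.ξ s = B.ξ t + n * σ → A.η s ≠ B.η t + n) :
    ∃ d : ℤ, ∀ x, B.top (x - d * σ) + d < A.top x ∧
      A.top x < B.top (x - (d + 1) * σ) + (d + 1) := by
  obtain ⟨M, hM⟩ := A.exists_abs_top_le
  obtain ⟨N, hN⟩ := B.exists_abs_top_le
  have hdich : ∀ n : ℤ, (∀ x, A.top x < B.top (x - n * σ) + n) ∨
      ∀ x, B.top (x - n * σ) + n < A.top x := by
    intro n
    have := top_lt_top_or (C := A) (C' := B.shift (n * σ) n) (hd n)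
    simpa only [top_shift] using this
  obtain ⟨K, hK⟩ := exists_nat_gt (M + N)
  have hlow : ¬ ∀ x, A.top x < B.top (x - ((-K : ℤ) : ℝ) * σ) + ((-K : ℤ) : ℝ) := by
    intro h
    have h1 := h 0
    have h2 := (abs_le.1 (hM 0)).1
    have h3 := (abs_le.1 (hN (0 - ((-K : ℤ) : ℝ) * σ))).2
    push_cast at h1 h3
    linarith
  have hstep : ∃ d : ℤ, (¬ ∀ x, A.top x < B.top (x - d * σ) + d) ∧
      ∀ x, A.top x < B.top (x - ((d + 1 : ℤ) : ℝ) * σ) + ((d + 1 : ℤ) : ℝ) := by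
    by_contra! hcon
    have hall : ∀ n : ℤ, -K ≤ n → ¬ ∀ x, A.top x < B.top (x - n * σ) + n := by
      intro n hn
      induction n, hn using Int.leInduction with
      | base => exact hlow
      | succ n _ ih =>
        intro h
        obtain ⟨x, hx⟩ := hcon n (not_forall.1 ih |>.imp fun _ ↦ not_lt.1)
        exact absurd (h x) (not_lt.2 hx)
    refine hall K (by omega) fun x ↦ ?_
    have h2 := (abs_le.1 (hM x)).2
    have h3 := (abs_le.1 (hN (x - (K : ℤ) * σ))).1
    push_cast at h3 ⊢
    linarith
  obtain ⟨d, hd1, hd2⟩ := hstep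
  refine ⟨d, fun x ↦ ⟨((hdich d).resolve_left hd1) x, ?_⟩⟩
  exact_mod_cast hd2 x

end HorizontalCurve

/-! ### The oscillation inequality on the flat torus -/

/-- The integral of a function on the plane over the unit square. -/
def squareIntegral (q : (Fin 2 → ℝ) → ℝ) : ℝ := ∫ y in (0 : ℝ)..1, ∫ x in (0 : ℝ)..1, q ![x, y]

/-- A function on the plane is doubly periodic if it is invariant under `ℤ²`. -/
def DoublyPeriodic {α : Type*} (q : (Fin 2 → ℝ) → α) : Prop :=
  ∀ (x : Fin 2 → ℝ) (n : Fin 2 → ℤ), q (x + fun i ↦ (n i : ℝ)) = q x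

theorem continuous_vecCons₂ {X : Type*} [TopologicalSpace X] {a b : X → ℝ} (ha : Continuous a)
    (hb : Continuous b) : Continuous fun z ↦ (![a z, b z] : Fin 2 → ℝ) := by
  refine continuous_pi fun i ↦ ?_
  fin_cases i
  · exact ha
  · exact hb

/-- The integral of a continuous doubly periodic function over the parallelogram with horizontal
base `[0, 1]` and slope `(-σ, 1)`, of integral height `N`, is `N` times its integral over the unit
square. -/
theorem integral_strip_eq {q : (Fin 2 → ℝ) → ℝ} (hq : Continuous q) (hper : DoublyPeriodic q)
    (σ : ℝ) (a : ℤ) (N : ℕ) :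
    (∫ x in (0 : ℝ)..1, ∫ y in (a : ℝ)..(a + N), q ![x - σ * y, y]) = N * squareIntegral q := by
  have hc : Continuous fun z : ℝ × ℝ ↦ q ![z.1 - σ * z.2, z.2] :=
    hq.comp (continuous_vecCons₂ (by fun_prop) (by fun_prop))
  have hper1 : ∀ y, Function.Periodic (fun x ↦ q ![x, y]) 1 := by
    intro y x
    have := hper ![x, y] ![1, 0]
    have h2 : (![x, y] + fun i ↦ ((![1, 0] : Fin 2 → ℤ) i : ℝ)) = ![x + 1, y] := by
      ext i; fin_cases i <;> simp
    simpa [h2] using this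
  have hper2 : Function.Periodic (fun y ↦ ∫ x in (0 : ℝ)..1, q ![x, y]) 1 := by
    intro y
    refine intervalIntegral.integral_congr fun x _ ↦ ?_
    have := hper ![x, y] ![0, 1]
    have h2 : (![x, y] + fun i ↦ ((![0, 1] : Fin 2 → ℤ) i : ℝ)) = ![x, y + 1] := by
      ext i; fin_cases i <;> simp
    simpa [h2] using this
  have hc2 : Continuous fun z : ℝ × ℝ ↦ q ![z.2, z.1] :=
    hq.comp (continuous_vecCons₂ (by fun_prop) (by fun_prop))
  have hJ : Continuous fun y ↦ ∫ x in (0 : ℝ)..1, q ![x, y] :=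
    intervalIntegral.continuous_parametric_intervalIntegral_of_continuous' hc2 0 1
  rw [intervalIntegral_intervalIntegral_swap]
  · have : ∀ y : ℝ, (∫ x in (0 : ℝ)..1, q ![x - σ * y, y]) = ∫ x in (0 : ℝ)..1, q ![x, y] := by
      intro y
      rw [intervalIntegral.integral_comp_sub_right (fun x ↦ q ![x, y]) (σ * y)]
      have := (hper1 y).intervalIntegral_add_eq (0 - σ * y) 0
      rw [show 0 - σ * y + 1 = 1 - σ * y by ring, zero_add] at this
      exact this
    simp_rw [this]
    have h := hper2.intervalIntegral_add_zsmul_eq N a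
      (fun t₁ t₂ ↦ hJ.intervalIntegrable t₁ t₂)
    simp only [zsmul_eq_mul, Int.cast_natCast, mul_one] at h
    rw [h, hper2.intervalIntegral_add_eq a 0, zero_add]
    rfl
  · exact (hc.continuousOn.integrableOn_compact (isCompact_uIcc.prod isCompact_uIcc)).mono_set
      (prod_mono uIoc_subset_uIcc uIoc_subset_uIcc)

/-- The variation of `L` between `b 0` and `b n` is at least `2 n (β - α)` if `L` is at least `β` at
the points `b j` and at most `α` at intermediate points `a j`. -/
theorem two_mul_le_integral_abs_deriv {L L' : ℝ → ℝ} (hL : ∀ t, HasDerivAt L (L' t) t)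
    (hL' : Continuous L') {α β : ℝ} {a b : ℕ → ℝ} (hba : ∀ j, b j ≤ a j)
    (hab : ∀ j, a j ≤ b (j + 1))
    (ha : ∀ j, L (a j) ≤ α) (hb : ∀ j, β ≤ L (b j)) (n : ℕ) :
    2 * n * (β - α) ≤ ∫ t in b 0..b n, |L' t| := by
  have hint : ∀ s t, IntervalIntegrable (fun t ↦ |L' t|) volume s t :=
    fun s t ↦ hL'.abs.intervalIntegrable s t
  have hle : ∀ s t, s ≤ t → |L t - L s| ≤ ∫ u in s..t, |L' u| := by
    intro s t hst
    rw [← intervalIntegral.integral_eq_sub_of_hasDerivAt (fun u _ ↦ hL u)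
      (hL'.intervalIntegrable s t)]
    exact intervalIntegral.abs_integral_le_integral_abs hst
  induction n with
  | zero => simp
  | succ n ih =>
    rw [← intervalIntegral.integral_add_adjacent_intervals (hint (b 0) (b n)) (hint _ (b (n + 1))),
      ← intervalIntegral.integral_add_adjacent_intervals (hint (b n) (a n)) (hint _ (b (n + 1)))]
    have h1 := (neg_le_abs _).trans (hle _ _ (hba n))
    have h2 := (le_abs_self _).trans (hle _ _ (hab n))
    have := ha n
    have := hb n
    have := hb (n + 1)
    push_cast
    linarith

/-- The image of a curve in the plane under the linear coordinates in which `(1, 0)` is horizontal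
and `(-σ, 1)` is vertical. -/
def shearedCurve (σ : ℝ) (Y : ℝ → Fin 2 → ℝ) (hY : Continuous Y) (k : ℝ) (hk : k ≠ 0)
    (hp : ∀ s, Y (s + 1) = Y s + ![k, 0]) : HorizontalCurve where
  ξ s := Y s 0 + σ * Y s 1
  η s := Y s 1
  k := k
  continuous_ξ := by fun_prop
  continuous_η := by fun_prop
  ξ_add_one s := by simp [hp]; ring
  η_add_one s := by simp [hp]
  k_ne_zero := hk

/-- **Oscillation inequality.** Let `w` be a doubly periodic function that is at most `α` on one
curve and at least `β` on another, both invariant under a horizontal translation. Along a line of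
direction `(-σ, 1)` the translates of these curves are met alternately, two per unit of height; so
the variation of `w` per unit of height is at least `2 (β - α)`, and one averages over all lines. -/
theorem two_mul_sub_le_squareIntegral {w : (Fin 2 → ℝ) → ℝ} (hw : ContDiff ℝ 1 w)
    (hper : DoublyPeriodic w) {Y Z : ℝ → Fin 2 → ℝ} (hY : Continuous Y) (hZ : Continuous Z)
    {k l : ℝ} (hk : k ≠ 0) (hl : l ≠ 0) (hYk : ∀ s, Y (s + 1) = Y s + ![k, 0])
    (hZl : ∀ s, Z (s + 1) = Z s + ![l, 0]) {α β : ℝ} (hα : ∀ s, w (Y s) ≤ α)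
    (hβ : ∀ s, β ≤ w (Z s)) (σ : ℝ) :
    2 * (β - α) ≤ squareIntegral fun y ↦ |fderiv ℝ w y ![-σ, 1]| := by
  set q : (Fin 2 → ℝ) → ℝ := fun y ↦ |fderiv ℝ w y ![-σ, 1]| with hqdef
  have hqc : Continuous q := by
    have := hw.continuous_fderiv one_ne_zero
    fun_prop
  have hqper : DoublyPeriodic q := by
    intro x n
    have : (fun y ↦ w (y + fun i ↦ (n i : ℝ))) = w := funext fun y ↦ hper y n
    simp only [q]
    rw [← fderiv_comp_add_right, this]
  have hq0 : ∀ y, 0 ≤ q y := fun y ↦ abs_nonneg _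
  rcases le_or_gt β α with hle | hlt
  · have : 0 ≤ squareIntegral q :=
      intervalIntegral.integral_nonneg zero_le_one fun y _ ↦
        intervalIntegral.integral_nonneg zero_le_one fun x _ ↦ hq0 _
    linarith
  let A := shearedCurve σ Y hY k hk hYk
  let B := shearedCurve σ Z hZ l hl hZl
  have hshift : ∀ (y : Fin 2 → ℝ) (n : ℤ) (z : Fin 2 → ℝ), z 0 = y 0 → z 1 = y 1 + n →
      w z = w y := by
    intro y n z h0 h1
    rw [← hper y ![0, n]]
    congr 1
    ext i
    fin_cases i
    · simp [h0]
    · simp [h1]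
  obtain ⟨d, hd⟩ := HorizontalCurve.exists_between_shifts (A := A) (B := B) (σ := σ) (by
    intro n s t h1 h2
    have h1' : Y s 0 + σ * Y s 1 = Z t 0 + σ * Z t 1 + n * σ := h1
    have h2' : Y s 1 = Z t 1 + n := h2
    have := hshift (Z t) n (Y s) (by rw [h2'] at h1'; linarith) h2'
    linarith [hα s, hβ t])
  obtain ⟨M, hM⟩ := B.exists_abs_top_le
  obtain ⟨K, hK⟩ := exists_nat_gt (M + |(d : ℝ)|)
  -- On every line, a strip of height `n + 2 K` contains `n` full oscillations.
  have hline : ∀ (n : ℕ) (x : ℝ), 2 * n * (β - α) ≤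
      ∫ y in ((-K : ℤ) : ℝ)..(((-K : ℤ) : ℝ) + (n + 2 * K : ℕ)), q ![x - σ * y, y] := by
    intro n x
    let a : ℕ → ℝ := fun j ↦ A.top (x - j * σ) + j
    let b : ℕ → ℝ := fun j ↦ B.top (x - (d + j) * σ) + (d + j)
    have hba : ∀ j, b j ≤ a j := fun j ↦ by
      have := (hd (x - j * σ)).1
      rw [show x - j * σ - d * σ = x - (d + j) * σ by ring] at this
      simp only [a, b]
      linarith
    have hab : ∀ j, a j ≤ b (j + 1) := fun j ↦ by
      have := (hd (x - j * σ)).2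
      rw [show x - j * σ - (d + 1) * σ = x - (d + (j + 1 : ℕ)) * σ by push_cast; ring] at this
      simp only [a, b]
      push_cast at this ⊢
      linarith
    let ℓ : ℝ → Fin 2 → ℝ := fun t ↦ ![x - σ * t, t]
    have hℓ : Continuous ℓ := continuous_vecCons₂ (by fun_prop) (by fun_prop)
    have hL : ∀ t, HasDerivAt (fun t ↦ w (ℓ t)) (fderiv ℝ w (ℓ t) ![-σ, 1]) t := by
      intro t
      have h1 : HasDerivAt ℓ ![-σ, 1] t := by
        rw [hasDerivAt_pi]
        intro i
        fin_cases i
        · simpa [ℓ] using ((hasDerivAt_id t).const_mul σ).const_sub x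
        · simpa [ℓ] using hasDerivAt_id' t
      exact ((hw.differentiable one_ne_zero _).hasFDerivAt).comp_hasDerivAt t h1
    have hL' : Continuous fun t ↦ fderiv ℝ w (ℓ t) ![-σ, 1] := by
      have := hw.continuous_fderiv one_ne_zero
      fun_prop
    have ha : ∀ j, w (ℓ (a j)) ≤ α := by
      intro j
      obtain ⟨s, hs, hs'⟩ := A.exists_eq_top (x - j * σ)
      have hs1 : Y s 0 + σ * Y s 1 = x - j * σ := hs
      have hs2 : Y s 1 = A.top (x - j * σ) := hs'
      rw [hshift (Y s) j (ℓ (a j)) _ _]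
      · exact hα s
      · simp only [ℓ, a, ← hs2, Matrix.cons_val_zero]
        linarith
      · simp [ℓ, a, ← hs2]
    have hb : ∀ j, β ≤ w (ℓ (b j)) := by
      intro j
      obtain ⟨s, hs, hs'⟩ := B.exists_eq_top (x - (d + j) * σ)
      have hs1 : Z s 0 + σ * Z s 1 = x - (d + j) * σ := hs
      have hs2 : Z s 1 = B.top (x - (d + j) * σ) := hs'
      rw [hshift (Z s) (d + j) (ℓ (b j)) _ _]
      · exact hβ s
      · simp only [ℓ, b, ← hs2, Matrix.cons_val_zero]
        linarith
      · simp [ℓ, b, ← hs2]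
    refine (two_mul_le_integral_abs_deriv hL hL' hba hab ha hb n).trans ?_
    have hmono : Monotone b := monotone_nat_of_le_succ fun j ↦ (hba j).trans (hab j)
    have hbj := fun j : ℕ ↦ abs_le.1 (hM (x - (d + j) * σ))
    have hd' := abs_le.1 (le_refl |(d : ℝ)|)
    refine intervalIntegral.integral_mono_interval ?_ (hmono (Nat.zero_le n)) ?_
      (.of_forall fun t ↦ abs_nonneg _) (hL'.abs.intervalIntegrable _ _)
    · have := (hbj 0).1
      simp only [b]
      push_cast at this ⊢
      linarith
    · have := (hbj n).2
      simp only [b]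
      push_cast at this ⊢
      linarith
  have hn : ∀ n : ℕ, n * (2 * (β - α) - squareIntegral q) ≤ 2 * K * squareIntegral q := by
    intro n
    have h1 := integral_strip_eq hqc hqper σ (-K) (n + 2 * K)
    have hc : Continuous fun z : ℝ × ℝ ↦ q ![z.1 - σ * z.2, z.2] :=
      hqc.comp (continuous_vecCons₂ (by fun_prop) (by fun_prop))
    have h2 : ∫ _ in (0 : ℝ)..1, 2 * n * (β - α) ≤ ∫ x in (0 : ℝ)..1,
        ∫ y in ((-K : ℤ) : ℝ)..(((-K : ℤ) : ℝ) + (n + 2 * K : ℕ)), q ![x - σ * y, y] :=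
      intervalIntegral.integral_mono zero_le_one (by simp)
        ((intervalIntegral.continuous_parametric_intervalIntegral_of_continuous' hc _ _
          ).intervalIntegrable _ _) (hline n)
    rw [h1] at h2
    simp only [intervalIntegral.integral_const, sub_zero, smul_eq_mul, one_mul] at h2
    push_cast at h2
    linarith
  by_contra! hcon
  obtain ⟨n, hn'⟩ := exists_nat_gt (2 * K * squareIntegral q / (2 * (β - α) - squareIntegral q))
  rw [div_lt_iff₀ (by linarith)] at hn'
  linarith [hn n]

/-! ### Functions on the torus as doubly periodic functions on the plane -/

theorem proj_add_intCast (x : Fin 2 → ℝ) (n : Fin 2 → ℤ) :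
    proj (x + fun i ↦ (n i : ℝ)) = proj x := by
  ext i
  simp only [proj, Pi.add_apply, AddCircle.coe_add]
  rw [add_eq_left]
  exact (AddCircle.coe_eq_zero_iff 1).2 ⟨n i, by simp⟩

theorem exists_eq_add_intCast_of_proj_eq {x y : Fin 2 → ℝ} (h : proj x = proj y) :
    ∃ n : Fin 2 → ℤ, y = x + fun i ↦ (n i : ℝ) := by
  have : ∀ i, ∃ n : ℤ, y i = x i + n := by
    intro i
    have h1 : ((x i : ℝ) : UnitAddCircle) = (y i : ℝ) := congrFun h i
    rw [eq_comm, ← sub_eq_zero, ← AddCircle.coe_sub, AddCircle.coe_eq_zero_iff] at h1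
    obtain ⟨n, hn⟩ := h1
    exact ⟨n, by rw [zsmul_eq_mul, mul_one] at hn; linarith⟩
  choose n hn using this
  exact ⟨n, funext hn⟩

theorem isOpenQuotientMap_proj : IsOpenQuotientMap proj :=
  IsOpenQuotientMap.piMap fun _ ↦ QuotientAddGroup.isOpenQuotientMap_mk

theorem continuous_proj : Continuous proj := isOpenQuotientMap_proj.continuous

theorem doublyPeriodic_comp_proj {α : Type*} (h : Torus → α) : DoublyPeriodic fun x ↦ h (proj x) :=
  fun x n ↦ congrArg h (proj_add_intCast x n)

theorem pderiv_proj {h : Torus → ℝ} {x : Fin 2 → ℝ} (i : Fin 2)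
    (hh : DifferentiableAt ℝ (fun x ↦ h (proj x)) x) :
    pderiv i h (proj x) = fderiv ℝ (fun x ↦ h (proj x)) x (Pi.single i 1) := by
  rw [← hh.lineDeriv_eq_fderiv, lineDeriv, pderiv]
  congr 1
  ext t
  congr 1
  ext j
  by_cases hj : j = i
  · subst hj; simp [proj]
  · simp [proj, hj]

/-! ### Integration over a unit cell -/

/-- The half-open unit square, a fundamental domain of `ℤ²`. -/
def unitCell : Set (Fin 2 → ℝ) := Set.pi univ fun _ ↦ Ioc 0 1

theorem measurableSet_unitCell : MeasurableSet unitCell :=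
  MeasurableSet.univ_pi fun _ ↦ measurableSet_Ioc

theorem squareIntegral_eq_setIntegral {q : (Fin 2 → ℝ) → ℝ} (hq : Continuous q) :
    squareIntegral q = ∫ x in unitCell, q x := by
  have hc : Continuous fun z : ℝ × ℝ ↦ q ![z.1, z.2] :=
    hq.comp (continuous_vecCons₂ (by fun_prop) (by fun_prop))
  have hi : IntegrableOn (fun z : ℝ × ℝ ↦ q ![z.1, z.2]) (Ioc 0 1 ×ˢ Ioc 0 1) :=
    (hc.continuousOn.integrableOn_compact (isCompact_Icc.prod isCompact_Icc)).mono_set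
      (prod_mono Ioc_subset_Icc_self Ioc_subset_Icc_self)
  have h1 := (volume_preserving_finTwoArrow ℝ).symm.setIntegral_preimage_emb
    (MeasurableEquiv.measurableEmbedding _) q unitCell
  have h2 : (MeasurableEquiv.finTwoArrow (α := ℝ)).symm ⁻¹' unitCell
      = Ioc (0 : ℝ) 1 ×ˢ Ioc (0 : ℝ) 1 := by
    ext z
    simp [unitCell, MeasurableEquiv.finTwoArrow, Fin.forall_fin_two]
  rw [← h1, h2, squareIntegral, intervalIntegral_intervalIntegral_swap]
  · rw [Measure.volume_eq_prod, setIntegral_prod _ (by exact hi)]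
    simp only [intervalIntegral.integral_of_le zero_le_one]
    rfl
  · rw [uIoc_of_le zero_le_one]
    have hc' : Continuous fun z : ℝ × ℝ ↦ q ![z.2, z.1] :=
      hq.comp (continuous_vecCons₂ (by fun_prop) (by fun_prop))
    exact (hc'.continuousOn.integrableOn_compact (isCompact_Icc.prod isCompact_Icc)).mono_set
      (prod_mono Ioc_subset_Icc_self Ioc_subset_Icc_self)

theorem integral_torus_eq_squareIntegral {h : Torus → ℝ} (hh : Continuous fun x ↦ h (proj x)) :
    ∫ p, h p = squareIntegral fun x ↦ h (proj x) := by
  have hc : Continuous h := isOpenQuotientMap_proj.isQuotientMap.continuous_iff.2 hh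
  have hmp : MeasurePreserving proj (volume.restrict unitCell) (volume : Measure Torus) := by
    have := measurePreserving_pi (fun _ : Fin 2 ↦ (volume : Measure ℝ).restrict (Ioc 0 1))
      (fun _ : Fin 2 ↦ (volume : Measure UnitAddCircle)) (f := fun _ x ↦ (x : UnitAddCircle))
      (fun _ ↦ by simpa using UnitAddCircle.measurePreserving_mk 0)
    rwa [← Measure.restrict_pi_pi] at this
  rw [squareIntegral_eq_setIntegral hh, ← hmp.map_eq,
    integral_map hmp.measurable.aemeasurable hc.aestronglyMeasurable]

theorem integrableOn_unitCell {q : (Fin 2 → ℝ) → ℝ} (hq : Continuous q) :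
    IntegrableOn q unitCell :=
  (hq.continuousOn.integrableOn_compact (isCompact_univ_pi fun _ ↦ isCompact_Icc)).mono_set
    (pi_mono fun _ _ ↦ Ioc_subset_Icc_self)

theorem squareIntegral_mono {q r : (Fin 2 → ℝ) → ℝ} (hq : Continuous q) (hr : Continuous r)
    (h : ∀ x, q x ≤ r x) : squareIntegral q ≤ squareIntegral r := by
  rw [squareIntegral_eq_setIntegral hq, squareIntegral_eq_setIntegral hr]
  exact setIntegral_mono (integrableOn_unitCell hq) (integrableOn_unitCell hr) h

theorem squareIntegral_add {q r : (Fin 2 → ℝ) → ℝ} (hq : Continuous q) (hr : Continuous r) :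
    squareIntegral (fun x ↦ q x + r x) = squareIntegral q + squareIntegral r := by
  rw [squareIntegral_eq_setIntegral hq, squareIntegral_eq_setIntegral hr,
    squareIntegral_eq_setIntegral (by fun_prop)]
  exact integral_add (integrableOn_unitCell hq) (integrableOn_unitCell hr)

theorem squareIntegral_const_mul (c : ℝ) (q : (Fin 2 → ℝ) → ℝ) :
    squareIntegral (fun x ↦ c * q x) = c * squareIntegral q := by
  simp [squareIntegral]

theorem squareIntegral_const (c : ℝ) : squareIntegral (fun _ ↦ c) = c := by
  simp [squareIntegral]

/-- The Cauchy–Schwarz inequality on the unit square. -/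
theorem squareIntegral_mul_sq_le {q r : (Fin 2 → ℝ) → ℝ} (hq : Continuous q) (hr : Continuous r) :
    squareIntegral (fun x ↦ q x * r x) ^ 2 ≤
      squareIntegral (fun x ↦ q x ^ 2) * squareIntegral (fun x ↦ r x ^ 2) := by
  have key : ∀ s : ℝ, 0 ≤ squareIntegral (fun x ↦ r x ^ 2) * (s * s) +
      (2 * squareIntegral (fun x ↦ q x * r x)) * s + squareIntegral (fun x ↦ q x ^ 2) := by
    intro s
    have h : squareIntegral (fun x ↦ (q x + s * r x) ^ 2) =
        squareIntegral (fun x ↦ r x ^ 2) * (s * s) +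
        (2 * squareIntegral (fun x ↦ q x * r x)) * s + squareIntegral (fun x ↦ q x ^ 2) := by
      rw [show (fun x ↦ (q x + s * r x) ^ 2) = fun x ↦ (s * s) * r x ^ 2 +
        ((2 * s) * (q x * r x) + q x ^ 2) from funext fun x ↦ by ring,
        squareIntegral_add (by fun_prop) (by fun_prop),
        squareIntegral_add (by fun_prop) (by fun_prop),
        squareIntegral_const_mul, squareIntegral_const_mul]
      ring
    rw [← h, ← squareIntegral_const 0]
    exact squareIntegral_mono continuous_const (by fun_prop) fun x ↦ sq_nonneg _
  have := discrim_le_zero key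
  rw [discrim] at this
  linarith

/-- The integral of a partial derivative of a doubly periodic function vanishes. -/
theorem squareIntegral_fderiv_eq_zero {h : (Fin 2 → ℝ) → ℝ} (hh : ContDiff ℝ 1 h)
    (hper : DoublyPeriodic h) (i : Fin 2) :
    squareIntegral (fun x ↦ fderiv ℝ h x (Pi.single i 1)) = 0 := by
  have hd := hh.continuous_fderiv one_ne_zero
  have hder : ∀ (i : Fin 2) (ℓ : ℝ → Fin 2 → ℝ), (∀ t, HasDerivAt ℓ (Pi.single i 1) t) →
      ∫ t in (0 : ℝ)..1, fderiv ℝ h (ℓ t) (Pi.single i 1) = h (ℓ 1) - h (ℓ 0) := by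
    intro i ℓ hℓ
    have hℓc : Continuous ℓ := continuous_iff_continuousAt.2 fun t ↦ (hℓ t).continuousAt
    refine intervalIntegral.integral_eq_sub_of_hasDerivAt (f := fun t ↦ h (ℓ t)) (fun t _ ↦ ?_)
      (Continuous.intervalIntegrable (by fun_prop) _ _)
    exact (hh.differentiable one_ne_zero _).hasFDerivAt.comp_hasDerivAt t (hℓ t)
  have hc : Continuous fun z : ℝ × ℝ ↦ fderiv ℝ h ![z.2, z.1] (Pi.single i 1) := by
    have : Continuous fun z : ℝ × ℝ ↦ (![z.2, z.1] : Fin 2 → ℝ) :=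
      continuous_vecCons₂ (by fun_prop) (by fun_prop)
    fun_prop
  rw [squareIntegral]
  fin_cases i
  · refine intervalIntegral.integral_zero_ae (.of_forall fun y _ ↦ ?_)
    have h1 : ∀ t : ℝ, HasDerivAt (fun x ↦ (![x, y] : Fin 2 → ℝ)) (Pi.single 0 1) t := by
      intro t
      rw [hasDerivAt_pi]
      intro j
      fin_cases j
      · simpa using hasDerivAt_id' t
      · simpa using hasDerivAt_const t y
    refine (hder 0 _ h1).trans ?_
    rw [sub_eq_zero, ← hper ![0, y] ![1, 0]]
    congr 1
    ext j; fin_cases j <;> simp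
  · rw [intervalIntegral_intervalIntegral_swap]
    · refine intervalIntegral.integral_zero_ae (.of_forall fun x _ ↦ ?_)
      have h1 : ∀ t : ℝ, HasDerivAt (fun y ↦ (![x, y] : Fin 2 → ℝ)) (Pi.single 1 1) t := by
        intro t
        rw [hasDerivAt_pi]
        intro j
        fin_cases j
        · simpa using hasDerivAt_const t x
        · simpa using hasDerivAt_id' t
      refine (hder 1 _ h1).trans ?_
      rw [sub_eq_zero, ← hper ![x, 0] ![0, 1]]
      congr 1
      ext j; fin_cases j <;> simp
    · exact (hc.continuousOn.integrableOn_compact (isCompact_uIcc.prod isCompact_uIcc)).mono_set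
        (prod_mono uIoc_subset_uIcc uIoc_subset_uIcc)

/-- The lattice `ℤ²` in the plane. -/
def intLattice : AddSubgroup (Fin 2 → ℝ) :=
  ((Int.castAddHom ℝ).compLeft (Fin 2)).range

instance : Countable intLattice := (Set.countable_range _).to_subtype

theorem isAddFundamentalDomain_of_existsUnique {s : Set (Fin 2 → ℝ)} (hs : MeasurableSet s)
    (h : ∀ y, ∃! n : Fin 2 → ℤ, (y + fun i ↦ (n i : ℝ)) ∈ s) :
    IsAddFundamentalDomain intLattice s volume := by
  refine .mk' hs.nullMeasurableSet fun y ↦ ?_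
  obtain ⟨n, hn, hn'⟩ := h y
  refine ⟨⟨_, ⟨n, rfl⟩⟩, ?_, ?_⟩
  · change (fun i ↦ (n i : ℝ)) + y ∈ s
    rwa [add_comm]
  · rintro ⟨_, ⟨m, rfl⟩⟩ hm
    have : m = n := hn' m (by
      change (fun i ↦ (m i : ℝ)) + y ∈ s at hm
      rwa [add_comm] at hm)
    subst this
    rfl

theorem existsUnique_add_mem_unitCell (y : Fin 2 → ℝ) :
    ∃! n : Fin 2 → ℤ, (y + fun i ↦ (n i : ℝ)) ∈ unitCell := by
  have h : ∀ i, ∃! n : ℤ, y i + n • (1 : ℝ) ∈ Ioc (0 : ℝ) (0 + 1) :=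
    fun i ↦ existsUnique_add_zsmul_mem_Ioc one_pos (y i) 0
  choose n hn hn' using h
  refine ⟨n, fun i _ ↦ by simpa using hn i, fun m hm ↦ funext fun i ↦ hn' i (m i) ?_⟩
  simpa using hm i trivial

/-- Change of variables on the torus: `Φ` descends to a diffeomorphism of `ℝ²/ℤ²`. -/
theorem squareIntegral_comp_mul_abs_det (Φ : (Fin 2 → ℝ) ≃ₜ (Fin 2 → ℝ)) (hΦ : ContDiff ℝ 1 Φ)
    (N : (Fin 2 → ℤ) ≃ (Fin 2 → ℤ))
    (hN : ∀ x (n : Fin 2 → ℤ), Φ (x + fun i ↦ (n i : ℝ)) = Φ x + fun i ↦ (N n i : ℝ))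
    {q : (Fin 2 → ℝ) → ℝ} (hq : Continuous q) (hper : DoublyPeriodic q) :
    squareIntegral (fun x ↦ q (Φ x) * |(fderiv ℝ Φ x).det|) = squareIntegral q := by
  have hdet : Continuous fun x ↦ (fderiv ℝ Φ x).det :=
    ContinuousLinearMap.continuous_det.comp (hΦ.continuous_fderiv one_ne_zero)
  have hfd := isAddFundamentalDomain_of_existsUnique measurableSet_unitCell
    existsUnique_add_mem_unitCell
  have hfd' : IsAddFundamentalDomain intLattice (Φ '' unitCell) volume := by
    refine isAddFundamentalDomain_of_existsUnique
      (Φ.measurableEmbedding.measurableSet_image' measurableSet_unitCell) fun y ↦ ?_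
    obtain ⟨n, hn, hn'⟩ := existsUnique_add_mem_unitCell (Φ.symm y)
    refine ⟨N n, ⟨_, hn, by rw [hN, Φ.apply_symm_apply]⟩, ?_⟩
    rintro m ⟨x, hx, hxm⟩
    obtain ⟨m, rfl⟩ := N.surjective m
    rw [hn' m]
    convert hx using 1
    apply Φ.injective
    rw [hxm, hN, Φ.apply_symm_apply]
  rw [squareIntegral_eq_setIntegral hq, squareIntegral_eq_setIntegral
    (by fun_prop), hfd.setIntegral_eq hfd' (f := q) (fun g x ↦ by
      obtain ⟨_, ⟨n, rfl⟩⟩ := g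
      rw [← hper x n, add_comm]
      rfl),
    integral_image_eq_integral_abs_det_fderiv_smul volume measurableSet_unitCell
      (fun x _ ↦ ((hΦ.differentiable one_ne_zero x).hasFDerivAt).hasFDerivWithinAt)
      Φ.injective.injOn]
  exact setIntegral_congr_fun measurableSet_unitCell fun x _ ↦ by simp [mul_comm]

/-! ### Loops in the torus and their lifts -/

/-- `γ` is a lift to the plane of the loop `c` in the torus, with total displacement `m`. -/
structure IsLift (c : C(UnitAddCircle, Torus)) (γ : ℝ → Fin 2 → ℝ) (m : Fin 2 → ℤ) : Prop where
  continuous : Continuous γ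
  proj_eq : ∀ t : ℝ, proj (γ t) = c (t : UnitAddCircle)
  add_one : ∀ t, γ (t + 1) = γ t + fun i ↦ (m i : ℝ)

theorem isLift_of_proj_eq {c : C(UnitAddCircle, Torus)} {γ : ℝ → Fin 2 → ℝ} (hγ : Continuous γ)
    (h : ∀ t : ℝ, proj (γ t) = c (t : UnitAddCircle)) : ∃ m, IsLift c γ m := by
  have hper : ∀ t : ℝ, proj (γ t) = proj (γ (t + 1)) := fun t ↦ by
    rw [h, h, AddCircle.coe_add_period]
  obtain ⟨m, hm⟩ := exists_eq_add_intCast_of_proj_eq (hper 0)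
  refine ⟨m, hγ, h, fun t ↦ funext fun i ↦ ?_⟩
  have hcov := AddCircle.isCoveringMap_coe (1 : ℝ)
  have := hcov.eq_of_comp_eq (g₁ := fun t ↦ γ (t + 1) i) (g₂ := fun t ↦ γ t i + m i)
    (by fun_prop) (by fun_prop) (funext fun t ↦ by
      have h1 : ((γ t i : ℝ) : UnitAddCircle) = (γ (t + 1) i : ℝ) := congrFun (hper t) i
      have h2 := congrFun (proj_add_intCast (γ t) m) i
      exact h1.symm.trans h2.symm) 0 (congrFun hm i)
  exact congrFun this t

theorem exists_isLift (c : C(UnitAddCircle, Torus)) : ∃ γ m, IsLift c γ m := by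
  have hcov := AddCircle.isCoveringMap_coe (1 : ℝ)
  have key : ∀ i : Fin 2, ∃ F : C(ℝ, ℝ), ∀ t : ℝ, ((F t : ℝ) : UnitAddCircle) = c t i := by
    intro i
    let f : C(ℝ, UnitAddCircle) := ⟨fun t ↦ c (t : UnitAddCircle) i, by fun_prop⟩
    obtain ⟨e, he⟩ := QuotientAddGroup.mk_surjective (f 0)
    obtain ⟨F, ⟨-, hF⟩, -⟩ := hcov.existsUnique_continuousMap_lifts f 0 e he
    exact ⟨F, fun t ↦ congrFun hF t⟩
  choose F hF using key
  obtain ⟨m, hm⟩ := isLift_of_proj_eq (c := c) (γ := fun t i ↦ F i t) (by fun_prop)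
    (fun t ↦ funext fun i ↦ hF i t)
  exact ⟨_, m, hm⟩

/-- A loop that lifts to a closed loop in the plane is null-homotopic. -/
theorem IsLift.nullhomotopic {c : C(UnitAddCircle, Torus)} {γ : ℝ → Fin 2 → ℝ}
    (h : IsLift c γ 0) : c.Nullhomotopic := by
  have hper : Function.Periodic γ 1 := fun t ↦ by
    rw [h.add_one]; ext i; simp
  let d : C(UnitAddCircle, Fin 2 → ℝ) := ⟨hper.lift,
    (QuotientAddGroup.isQuotientMap_mk _).continuous_iff.2 h.continuous⟩
  have hd : c = (⟨proj, continuous_proj⟩ : C(Fin 2 → ℝ, Torus)).comp d := by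
    ext1 t
    induction t using QuotientAddGroup.induction_on with
    | H t => exact (h.proj_eq t).symm
  rw [hd]
  refine ContinuousMap.Nullhomotopic.comp_right ?_ _
  have := (id_nullhomotopic (Fin 2 → ℝ)).comp_left d
  simpa using this

/-- Null-homotopic loops are homologous to zero: a constant map factors through a point, whose
first homology vanishes. -/
theorem nullHomologous_of_nullhomotopic {c : C(UnitAddCircle, Torus)} (h : c.Nullhomotopic) :
    NullHomologous c := by
  obtain ⟨p, ⟨H⟩⟩ := h
  rw [NullHomologous]
  have h1 := TopCat.Homotopy.congr_homologyMap_singularChainComplexFunctor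
    (f := TopCat.ofHom c) (g := TopCat.ofHom (ContinuousMap.const UnitAddCircle p))
    H (ModuleCat.of ℤ ℤ) 1
  refine Eq.trans h1 ?_
  have h2 : TopCat.ofHom (ContinuousMap.const UnitAddCircle p) =
      CategoryTheory.CategoryStruct.comp
        (TopCat.ofHom (ContinuousMap.const UnitAddCircle PUnit.unit))
        (TopCat.ofHom (ContinuousMap.const PUnit.{1} p)) := rfl
  have hz := AlgebraicTopology.isZero_singularHomologyFunctor_of_totallyDisconnectedSpace
    (ModuleCat.{0} ℤ) 1 (ModuleCat.of ℤ ℤ) (TopCat.of PUnit.{1}) one_ne_zero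
  change ((AlgebraicTopology.singularHomologyFunctor (ModuleCat.{0} ℤ) 1).obj
    (ModuleCat.of ℤ ℤ)).map _ = 0
  rw [h2, CategoryTheory.Functor.map_comp]
  rw [hz.eq_zero_of_tgt (((AlgebraicTopology.singularHomologyFunctor (ModuleCat.{0} ℤ) 1).obj
    (ModuleCat.of ℤ ℤ)).map (TopCat.ofHom (ContinuousMap.const UnitAddCircle PUnit.unit))),
    CategoryTheory.Limits.zero_comp]

/-- A loop whose lift has nonzero displacement is not null-homotopic. -/
theorem IsLift.not_nullhomotopic {c : C(UnitAddCircle, Torus)} {γ : ℝ → Fin 2 → ℝ}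
    {m : Fin 2 → ℤ} (h : IsLift c γ m) (hm : m ≠ 0) : ¬ c.Nullhomotopic := by
  rintro ⟨p, ⟨H⟩⟩
  obtain ⟨i, hi⟩ : ∃ i, m i ≠ 0 := Function.ne_iff.1 hm
  have hcov := AddCircle.isCoveringMap_coe (1 : ℝ)
  -- Lift the homotopy from the constant loop to `c`, reading the circle as the quotient of `ℝ`.
  let f : C(ℝ × ℝ, UnitAddCircle) :=
    ⟨fun z ↦ H (projIcc 0 1 zero_le_one z.1, (z.2 : UnitAddCircle)) i, by
      have h1 : Continuous fun z : ℝ × ℝ ↦ projIcc (0 : ℝ) 1 zero_le_one z.1 :=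
        continuous_projIcc.comp continuous_fst
      have h2 : Continuous fun z : ℝ × ℝ ↦ (z.2 : UnitAddCircle) :=
        (AddCircle.continuous_mk' 1).comp continuous_snd
      exact (continuous_apply i).comp (H.continuous.comp (h1.prodMk h2))⟩
  obtain ⟨e, he⟩ := QuotientAddGroup.mk_surjective (f 0)
  obtain ⟨F, ⟨-, hF⟩, -⟩ := hcov.existsUnique_continuousMap_lifts f 0 e he
  replace hF : ∀ z, ((F z : ℝ) : UnitAddCircle) = f z := fun z ↦ congrFun hF z
  have hδ : Continuous fun s : ℝ ↦ F (s, 1) - F (s, 0) := by fun_prop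
  have hconst := hcov.const_of_comp hδ (fun a b ↦ by
    have : ∀ a : ℝ, ((F (a, 1) - F (a, 0) : ℝ) : UnitAddCircle) = 0 := by
      intro a
      rw [AddCircle.coe_sub, hF, hF]
      have : ((1 : ℝ) : UnitAddCircle) = ((0 : ℝ) : UnitAddCircle) := by
        rw [AddCircle.coe_zero]; exact AddCircle.coe_period 1
      simp [f, this]
    rw [this, this]) 0 1
  have h1 : F (1, 1) - F (1, 0) = 0 := by
    have := hcov.const_of_comp (g := fun t : ℝ ↦ F (1, t)) (by fun_prop) (fun a b ↦ by
      rw [hF, hF]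
      simp [f]) 1 0
    linarith
  have h0 : F (0, 1) - F (0, 0) = m i := by
    have h2 := hcov.const_of_comp (g := fun t : ℝ ↦ F (0, t) - γ t i)
      (by have := h.continuous; fun_prop) (fun a b ↦ by
        have : ∀ a : ℝ, ((F (0, a) - γ a i : ℝ) : UnitAddCircle) = 0 := by
          intro a
          have h3 : ((γ a i : ℝ) : UnitAddCircle) = c a i := congrFun (h.proj_eq a) i
          rw [AddCircle.coe_sub, hF, h3]
          simp [f]
        rw [this, this]) 1 0
    have h4 := congrFun (h.add_one 0) i
    simp only [zero_add, Pi.add_apply] at h4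
    linarith
  apply hi
  have : (m i : ℝ) = 0 := by linarith
  exact_mod_cast this

/-! ### Curvature in terms of a triangular orthonormal coframe -/

/-- The partial derivative `∂ᵢ h` of a function on the plane. -/
def partialD (i : Fin 2) (h : (Fin 2 → ℝ) → ℝ) (x : Fin 2 → ℝ) : ℝ := fderiv ℝ h x (Pi.single i 1)

theorem contDiff_partialD {h : (Fin 2 → ℝ) → ℝ} (hh : ContDiff ℝ ∞ h) (i : Fin 2) :
    ContDiff ℝ ∞ (partialD i h) :=
  (hh.fderiv_right (m := ∞) (by simp)).clm_apply contDiff_const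

theorem differentiableAt_of_contDiff {h : (Fin 2 → ℝ) → ℝ} (hh : ContDiff ℝ ∞ h) (x : Fin 2 → ℝ) :
    DifferentiableAt ℝ h x :=
  hh.differentiable (by simp) x

theorem partialD_add {a b : (Fin 2 → ℝ) → ℝ} (ha : ContDiff ℝ ∞ a) (hb : ContDiff ℝ ∞ b)
    (i : Fin 2) (x : Fin 2 → ℝ) :
    partialD i (fun y ↦ a y + b y) x = partialD i a x + partialD i b x := by
  simp only [partialD]
  rw [fderiv_fun_add (differentiableAt_of_contDiff ha x) (differentiableAt_of_contDiff hb x)]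
  rfl

theorem partialD_sub {a b : (Fin 2 → ℝ) → ℝ} (ha : ContDiff ℝ ∞ a) (hb : ContDiff ℝ ∞ b)
    (i : Fin 2) (x : Fin 2 → ℝ) :
    partialD i (fun y ↦ a y - b y) x = partialD i a x - partialD i b x := by
  simp only [partialD]
  rw [fderiv_fun_sub (differentiableAt_of_contDiff ha x) (differentiableAt_of_contDiff hb x)]
  rfl

theorem partialD_mul {a b : (Fin 2 → ℝ) → ℝ} (ha : ContDiff ℝ ∞ a) (hb : ContDiff ℝ ∞ b)
    (i : Fin 2) (x : Fin 2 → ℝ) :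
    partialD i (fun y ↦ a y * b y) x = partialD i a x * b x + a x * partialD i b x := by
  simp only [partialD]
  rw [fderiv_fun_mul (differentiableAt_of_contDiff ha x) (differentiableAt_of_contDiff hb x)]
  simp
  ring

theorem partialD_div {a b : (Fin 2 → ℝ) → ℝ} (ha : ContDiff ℝ ∞ a) (hb : ContDiff ℝ ∞ b)
    (hb0 : ∀ y, b y ≠ 0) (i : Fin 2) (x : Fin 2 → ℝ) :
    partialD i (fun y ↦ a y / b y) x = (partialD i a x * b x - a x * partialD i b x) / b x ^ 2 := by
  have h := partialD_mul (a := fun y ↦ a y / b y) (ha.div hb hb0) hb i x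
  have h2 : (fun y ↦ a y / b y * b y) = a := funext fun y ↦ div_mul_cancel₀ _ (hb0 y)
  rw [h2] at h
  have := hb0 x
  rw [h]
  field_simp
  ring

theorem partialD_comm {h : (Fin 2 → ℝ) → ℝ} (hh : ContDiff ℝ ∞ h) (i j : Fin 2) (x : Fin 2 → ℝ) :
    partialD i (partialD j h) x = partialD j (partialD i h) x := by
  have key : ∀ i j, partialD i (partialD j h) x =
      fderiv ℝ (fderiv ℝ h) x (Pi.single i 1) (Pi.single j 1) := by
    intro i j
    have hd : DifferentiableAt ℝ (fderiv ℝ h) x :=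
      (hh.fderiv_right (m := ∞) (by simp)).differentiable (by simp) x
    have : partialD j h = fun y ↦ fderiv ℝ h y (Pi.single j 1) := rfl
    rw [partialD, this, fderiv_clm_apply hd (differentiableAt_const _)]
    simp
  rw [key, key]
  exact (hh.contDiffAt.isSymmSndFDerivAt (by
    simpa using WithTop.coe_le_coe.2 (le_top (a := (2 : ℕ∞))))) _ _

theorem doublyPeriodic_partialD {h : (Fin 2 → ℝ) → ℝ} (hh : DoublyPeriodic h) (i : Fin 2) :
    DoublyPeriodic (partialD i h) := by
  intro x n
  have : (fun y ↦ h (y + fun i ↦ (n i : ℝ))) = h := funext fun y ↦ hh y n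
  simp only [partialD]
  rw [← fderiv_comp_add_right, this]

namespace Metric

variable (g : Metric)

/-- The `∂₀`-component of the first form of the orthonormal coframe
`θ₁ = e dx₀ + f dx₁`, `θ₂ = d dx₁`. -/
def coframeE (x : Fin 2 → ℝ) : ℝ := √(g.gram (proj x) 0 0)

/-- The `∂₁`-component of the first form of the orthonormal coframe. -/
def coframeF (x : Fin 2 → ℝ) : ℝ := g.gram (proj x) 0 1 / g.coframeE x

/-- The `∂₁`-component of the second form of the orthonormal coframe. -/
def coframeD (x : Fin 2 → ℝ) : ℝ := √(g.gram (proj x)).det / g.coframeE x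

/-- The `dx₀`-component of the connection form of the orthonormal coframe. -/
def connA (x : Fin 2 → ℝ) : ℝ :=
  (partialD 1 g.coframeE x - partialD 0 g.coframeF x) / g.coframeD x

/-- The `dx₁`-component of the connection form of the orthonormal coframe. -/
def connB (x : Fin 2 → ℝ) : ℝ :=
  (g.connA x * g.coframeF x - partialD 0 g.coframeD x) / g.coframeE x

theorem gram_symm (p : Torus) : g.gram p 1 0 = g.gram p 0 1 := by
  simpa using (g.posDef p).isHermitian.apply 0 1

theorem det_gram_pos (p : Torus) : 0 < (g.gram p).det := (g.posDef p).det_pos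

theorem gram_zero_zero_pos (p : Torus) : 0 < g.gram p 0 0 := (g.posDef p).diag_pos

theorem contDiff_det : ContDiff ℝ ∞ fun x ↦ (g.gram (proj x)).det := by
  simp only [det_fin_two]
  exact ((g.smooth 0 0).mul (g.smooth 1 1)).sub ((g.smooth 0 1).mul (g.smooth 1 0))

theorem contDiff_sqrt_det : ContDiff ℝ ∞ fun x ↦ √(g.gram (proj x)).det :=
  g.contDiff_det.sqrt fun _ ↦ (g.det_gram_pos _).ne'

theorem coframeE_pos (x : Fin 2 → ℝ) : 0 < g.coframeE x := Real.sqrt_pos.2 (g.gram_zero_zero_pos _)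

theorem coframeD_pos (x : Fin 2 → ℝ) : 0 < g.coframeD x :=
  div_pos (Real.sqrt_pos.2 (g.det_gram_pos _)) (g.coframeE_pos x)

theorem contDiff_coframeE : ContDiff ℝ ∞ g.coframeE :=
  (g.smooth 0 0).sqrt fun _ ↦ (g.gram_zero_zero_pos _).ne'

theorem contDiff_coframeF : ContDiff ℝ ∞ g.coframeF :=
  (g.smooth 0 1).div g.contDiff_coframeE fun x ↦ (g.coframeE_pos x).ne'

theorem contDiff_coframeD : ContDiff ℝ ∞ g.coframeD :=
  g.contDiff_sqrt_det.div g.contDiff_coframeE fun x ↦ (g.coframeE_pos x).ne'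

theorem contDiff_connA : ContDiff ℝ ∞ g.connA :=
  ((contDiff_partialD g.contDiff_coframeE 1).sub (contDiff_partialD g.contDiff_coframeF 0)).div
    g.contDiff_coframeD fun x ↦ (g.coframeD_pos x).ne'

theorem contDiff_connB : ContDiff ℝ ∞ g.connB :=
  ((g.contDiff_connA.mul g.contDiff_coframeF).sub (contDiff_partialD g.contDiff_coframeD 0)).div
    g.contDiff_coframeE fun x ↦ (g.coframeE_pos x).ne'

theorem gram_zero_zero_eq (x : Fin 2 → ℝ) : g.gram (proj x) 0 0 = g.coframeE x * g.coframeE x :=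
  (Real.mul_self_sqrt (g.gram_zero_zero_pos _).le).symm

theorem gram_zero_one_eq (x : Fin 2 → ℝ) : g.gram (proj x) 0 1 = g.coframeE x * g.coframeF x :=
  (mul_div_cancel₀ _ (g.coframeE_pos x).ne').symm

theorem sqrt_det_eq (x : Fin 2 → ℝ) : √(g.gram (proj x)).det = g.coframeE x * g.coframeD x :=
  (mul_div_cancel₀ _ (g.coframeE_pos x).ne').symm

theorem gram_one_one_eq (x : Fin 2 → ℝ) :
    g.gram (proj x) 1 1 = g.coframeF x * g.coframeF x + g.coframeD x * g.coframeD x := by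
  have h := Real.mul_self_sqrt (g.det_gram_pos (proj x)).le
  have he := (g.coframeE_pos x).ne'
  rw [sqrt_det_eq, det_fin_two, gram_symm, gram_zero_zero_eq, gram_zero_one_eq] at h
  have : g.coframeE x * g.coframeE x * (g.gram (proj x) 1 1) = g.coframeE x * g.coframeE x *
      (g.coframeF x * g.coframeF x + g.coframeD x * g.coframeD x) := by linarith
  exact mul_left_cancel₀ (mul_ne_zero he he) this

/-- The Christoffel symbols of the first kind, as functions on the plane. -/
def christoffelLower (l i j : Fin 2) (x : Fin 2 → ℝ) : ℝ :=
  (1 / 2) * (partialD i (fun y ↦ g.gram (proj y) j l) x +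
    partialD j (fun y ↦ g.gram (proj y) i l) x - partialD l (fun y ↦ g.gram (proj y) i j) x)

theorem contDiff_christoffelLower (l i j : Fin 2) : ContDiff ℝ ∞ (g.christoffelLower l i j) :=
  contDiff_const.mul (((contDiff_partialD (g.smooth j l) i).add
    (contDiff_partialD (g.smooth i l) j)).sub (contDiff_partialD (g.smooth i j) l))

theorem christoffel_proj (k i j : Fin 2) (x : Fin 2 → ℝ) :
    g.christoffel k i j (proj x) = ∑ l, (g.gram (proj x))⁻¹ k l * g.christoffelLower l i j x := by
  have h : ∀ i j l, pderiv i (fun q ↦ g.gram q j l) (proj x) =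
      partialD i (fun y ↦ g.gram (proj y) j l) x := fun i j l ↦
    pderiv_proj i (differentiableAt_of_contDiff (g.smooth j l) x)
  simp only [christoffel, h, christoffelLower, Finset.mul_sum]
  exact Finset.sum_congr rfl fun l _ ↦ by ring

theorem contDiff_christoffel (k i j : Fin 2) :
    ContDiff ℝ ∞ fun x ↦ g.christoffel k i j (proj x) := by
  simp only [christoffel_proj]
  refine ContDiff.sum fun l _ ↦ ContDiff.mul ?_ (g.contDiff_christoffelLower l i j)
  simp only [Matrix.inv_def, Ring.inverse_eq_inv', Matrix.smul_apply, smul_eq_mul]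
  refine (g.contDiff_det.inv fun x ↦ (g.det_gram_pos _).ne').mul ?_
  have : ∀ k l : Fin 2, ContDiff ℝ ∞ fun x ↦ (g.gram (proj x)).adjugate k l := by
    intro k l
    simp only [adjugate_fin_two]
    fin_cases k <;> fin_cases l
    · exact g.smooth 1 1
    · exact (g.smooth 0 1).neg
    · exact (g.smooth 1 0).neg
    · exact g.smooth 0 0
  exact this k l

theorem sum_gram_mul_christoffel (l i j : Fin 2) (x : Fin 2 → ℝ) :
    g.gram (proj x) l 0 * g.christoffel 0 i j (proj x) +
      g.gram (proj x) l 1 * g.christoffel 1 i j (proj x) = g.christoffelLower l i j x := by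
  have hu : IsUnit (g.gram (proj x)).det := (g.det_gram_pos _).ne'.isUnit
  have h := Matrix.mul_nonsing_inv _ hu
  have h' : ∀ m, g.gram (proj x) l 0 * (g.gram (proj x))⁻¹ 0 m +
      g.gram (proj x) l 1 * (g.gram (proj x))⁻¹ 1 m = (1 : Matrix (Fin 2) (Fin 2) ℝ) l m := by
    intro m
    rw [← h, Matrix.mul_apply, Fin.sum_univ_two]
  have h0 := h' 0
  have h1 := h' 1
  simp only [christoffel_proj, Fin.sum_univ_two]
  have : ∀ l, (1 : Matrix (Fin 2) (Fin 2) ℝ) l 0 * g.christoffelLower 0 i j x +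
      (1 : Matrix (Fin 2) (Fin 2) ℝ) l 1 * g.christoffelLower 1 i j x
      = g.christoffelLower l i j x := by
    rw [Fin.forall_fin_two]
    simp
  rw [← this l, ← h0, ← h1]
  ring

set_option linter.unusedSimpArgs false in
/-- The Gaussian curvature is the exterior derivative of the connection form of the coframe. -/
theorem gaussCurvature_mul_sqrt_det (x : Fin 2 → ℝ) :
    g.gaussCurvature (proj x) * √(g.gram (proj x)).det =
      partialD 0 g.connB x - partialD 1 g.connA x := by
  set e := g.coframeE with hedef
  set f := g.coframeF with hfdef
  set d := g.coframeD with hddef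
  have he : ContDiff ℝ ∞ e := g.contDiff_coframeE
  have hf : ContDiff ℝ ∞ f := g.contDiff_coframeF
  have hd : ContDiff ℝ ∞ d := g.contDiff_coframeD
  have he0 : ∀ y, e y ≠ 0 := fun y ↦ (g.coframeE_pos y).ne'
  have hd0 : ∀ y, d y ≠ 0 := fun y ↦ (g.coframeD_pos y).ne'
  have hG00 : (fun y ↦ g.gram (proj y) 0 0) = fun y ↦ e y * e y := funext g.gram_zero_zero_eq
  have hG01 : (fun y ↦ g.gram (proj y) 0 1) = fun y ↦ e y * f y := funext g.gram_zero_one_eq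
  have hG10 : (fun y ↦ g.gram (proj y) 1 0) = fun y ↦ e y * f y :=
    funext fun y ↦ (g.gram_symm _).trans (g.gram_zero_one_eq y)
  have hG11 : (fun y ↦ g.gram (proj y) 1 1) = fun y ↦ f y * f y + d y * d y :=
    funext g.gram_one_one_eq
  have he' := contDiff_partialD he
  have hf' := contDiff_partialD hf
  have hd' := contDiff_partialD hd
  -- The first derivatives of the Gram matrix, and the Christoffel symbols of the first kind.
  have d00 : ∀ i y, partialD i (fun y ↦ g.gram (proj y) 0 0) y = 2 * e y * partialD i e y := by
    intro i y; rw [hG00, partialD_mul he he]; ring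
  have d01 : ∀ i y, partialD i (fun y ↦ g.gram (proj y) 0 1) y =
      partialD i e y * f y + e y * partialD i f y := by
    intro i y; rw [hG01, partialD_mul he hf]
  have d10 : ∀ i y, partialD i (fun y ↦ g.gram (proj y) 1 0) y =
      partialD i e y * f y + e y * partialD i f y := by
    intro i y; rw [hG10, partialD_mul he hf]
  have d11 : ∀ i y, partialD i (fun y ↦ g.gram (proj y) 1 1) y =
      2 * f y * partialD i f y + 2 * d y * partialD i d y := by
    intro i y
    rw [hG11, partialD_add (hf.mul hf) (hd.mul hd), partialD_mul hf hf, partialD_mul hd hd]; ring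
  have l011 : g.christoffelLower 0 1 1 = fun y ↦ (partialD 1 e y * f y + e y * partialD 1 f y) -
      (f y * partialD 0 f y + d y * partialD 0 d y) := by
    funext y; simp only [christoffelLower, d00, d01, d10, d11]; ring
  have l111 : g.christoffelLower 1 1 1 = fun y ↦ f y * partialD 1 f y + d y * partialD 1 d y := by
    funext y; simp only [christoffelLower, d00, d01, d10, d11]; ring
  have l001 : g.christoffelLower 0 0 1 = fun y ↦ e y * partialD 1 e y := by
    funext y; simp only [christoffelLower, d00, d01, d10, d11]; ring
  have l101 : g.christoffelLower 1 0 1 = fun y ↦ f y * partialD 0 f y + d y * partialD 0 d y := by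
    funext y; simp only [christoffelLower, d00, d01, d10, d11]; ring
  have l010 : g.christoffelLower 0 1 0 = fun y ↦ e y * partialD 1 e y := by
    funext y; simp only [christoffelLower, d00, d01, d10, d11]; ring
  have l110 : g.christoffelLower 1 1 0 = fun y ↦ f y * partialD 0 f y + d y * partialD 0 d y := by
    funext y; simp only [christoffelLower, d00, d01, d10, d11]; ring
  have l000 : g.christoffelLower 0 0 0 = fun y ↦ e y * partialD 0 e y := by
    funext y; simp only [christoffelLower, d00, d01, d10, d11]; ring
  have l100 : g.christoffelLower 1 0 0 = fun y ↦ partialD 0 e y * f y + e y * partialD 0 f y -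
      e y * partialD 1 e y := by
    funext y; simp only [christoffelLower, d00, d01, d10, d11]; ring
  -- The Christoffel symbols of the second kind at the point.
  have hΓ : ∀ i j, g.christoffel 1 i j (proj x) = (e x * g.christoffelLower 1 i j x -
        f x * g.christoffelLower 0 i j x) / (e x * d x ^ 2) ∧
      g.christoffel 0 i j (proj x) = ((f x ^ 2 + d x ^ 2) * g.christoffelLower 0 i j x -
        e x * f x * g.christoffelLower 1 i j x) / (e x ^ 2 * d x ^ 2) := by
    intro i j
    have h0 := g.sum_gram_mul_christoffel 0 i j x
    have h1 := g.sum_gram_mul_christoffel 1 i j x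
    rw [congrFun hG00 x, congrFun hG01 x] at h0
    rw [congrFun hG10 x, congrFun hG11 x] at h1
    have := he0 x
    have := hd0 x
    rw [← h0, ← h1]
    constructor
    · field_simp; ring
    · field_simp; ring
  -- Differentiating the relation `∑ₗ g₀ₗ Γˡᵢⱼ = Γ₀ᵢⱼ` avoids differentiating the inverse matrix.
  have hder : ∀ k i j, g.gram (proj x) 0 0 * pderiv k (g.christoffel 0 i j) (proj x) +
      g.gram (proj x) 1 0 * pderiv k (g.christoffel 1 i j) (proj x) =
      partialD k (g.christoffelLower 0 i j) x -
      (2 * e x * partialD k e x * g.christoffel 0 i j (proj x) +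
      (partialD k e x * f x + e x * partialD k f x) * g.christoffel 1 i j (proj x)) := by
    intro k i j
    have h : g.christoffelLower 0 i j = fun y ↦ (e y * e y) * g.christoffel 0 i j (proj y) +
        (e y * f y) * g.christoffel 1 i j (proj y) := by
      funext y
      rw [← g.sum_gram_mul_christoffel, congrFun hG00 y, congrFun hG01 y]
    have hΓ0 := g.contDiff_christoffel 0 i j
    have hΓ1 := g.contDiff_christoffel 1 i j
    rw [pderiv_proj k (differentiableAt_of_contDiff hΓ0 x),
      pderiv_proj k (differentiableAt_of_contDiff hΓ1 x), h,
      partialD_add ((he.mul he).mul hΓ0) ((he.mul hf).mul hΓ1), partialD_mul (he.mul he) hΓ0,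
      partialD_mul (he.mul hf) hΓ1, partialD_mul he he, partialD_mul he hf, congrFun hG00 x,
      congrFun hG10 x]
    simp only [partialD]
    ring
  -- The derivatives of the connection form.
  have hA : g.connA = fun y ↦ (partialD 1 e y - partialD 0 f y) / d y := rfl
  have hB : g.connB = fun y ↦ (g.connA y * f y - partialD 0 d y) / e y := rfl
  have dA : ∀ i, partialD i g.connA x = ((partialD i (partialD 1 e) x - partialD i (partialD 0 f) x)
      * d x - (partialD 1 e x - partialD 0 f x) * partialD i d x) / d x ^ 2 := by
    intro i
    rw [hA, partialD_div ((he' 1).sub (hf' 0)) hd hd0, partialD_sub (he' 1) (hf' 0)]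
  have dB : partialD 0 g.connB x = ((partialD 0 g.connA x * f x + g.connA x * partialD 0 f x -
      partialD 0 (partialD 0 d) x) * e x - (g.connA x * f x - partialD 0 d x) * partialD 0 e x)
      / e x ^ 2 := by
    rw [hB, partialD_div ((g.contDiff_connA.mul hf).sub (hd' 0)) he he0,
      partialD_sub (g.contDiff_connA.mul hf) (hd' 0), partialD_mul g.contDiff_connA hf]
  have D011 : partialD 0 (g.christoffelLower 0 1 1) x =
      (partialD 0 (partialD 1 e) x * f x + partialD 1 e x * partialD 0 f x +
      (partialD 0 e x * partialD 1 f x + e x * partialD 0 (partialD 1 f) x)) -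
      ((partialD 0 f x * partialD 0 f x + f x * partialD 0 (partialD 0 f) x) +
      (partialD 0 d x * partialD 0 d x + d x * partialD 0 (partialD 0 d) x)) := by
    rw [l011, partialD_sub (((he' 1).mul hf).add (he.mul (hf' 1)))
      ((hf.mul (hf' 0)).add (hd.mul (hd' 0))), partialD_add ((he' 1).mul hf) (he.mul (hf' 1)),
      partialD_add (hf.mul (hf' 0)) (hd.mul (hd' 0)), partialD_mul (he' 1) hf,
      partialD_mul he (hf' 1), partialD_mul hf (hf' 0), partialD_mul hd (hd' 0)]
  have D001 : partialD 1 (g.christoffelLower 0 0 1) x =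
      partialD 1 e x * partialD 1 e x + e x * partialD 1 (partialD 1 e) x := by
    rw [l001, partialD_mul he (he' 1)]
  have hsymm := partialD_comm hf 1 0 x
  have hK : (∑ l, g.gram (proj x) l 0 * g.riemann l 0 1 1 (proj x)) =
      (partialD 0 g.connB x - partialD 1 g.connA x) * (e x * d x) := by
    have h1 := hder 0 1 1
    have h2 := hder 1 0 1
    rw [D011] at h1
    rw [D001] at h2
    simp only [riemann, Fin.sum_univ_two]
    have hsplit : ∀ a b p₀ q₀ p₁ q₁ r₀ r₁ : ℝ, a * (p₀ - q₀ + r₀) + b * (p₁ - q₁ + r₁) =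
        (a * p₀ + b * p₁) - (a * q₀ + b * q₁) + (a * r₀ + b * r₁) := by
      intros; ring
    rw [hsplit, h1, h2, dB, dA, dA, congrFun hG00 x, congrFun hG10 x, hsymm]
    simp only [(hΓ _ _).1, (hΓ _ _).2, l011, l111, l001, l101, l010, l110, l000, l100, hA]
    have := he0 x
    have := hd0 x
    field_simp
    ring
  have hdet : (g.gram (proj x)).det = (e x * d x) * (e x * d x) := by
    rw [← g.sqrt_det_eq, Real.mul_self_sqrt (g.det_gram_pos _).le]
  rw [gaussCurvature, hK, g.sqrt_det_eq, hdet]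
  have := he0 x
  have := hd0 x
  change _ / _ * (e x * d x) = _
  field_simp

end Metric

/-! ### The developing map of a flat metric -/

/-- The Poincaré lemma in the plane: the form `P dx₀ + R dx₁` is exact if it is closed. -/
theorem exists_potential {V : Type*} [NormedAddCommGroup V] [NormedSpace ℝ V] [CompleteSpace V]
    {P R : (Fin 2 → ℝ) → V} (hP : ContDiff ℝ ∞ P) (hR : ContDiff ℝ ∞ R)
    (hcl : ∀ x, fderiv ℝ R x (Pi.single 0 1) = fderiv ℝ P x (Pi.single 1 1)) :
    ∃ F : (Fin 2 → ℝ) → V, ContDiff ℝ ∞ F ∧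
      ∀ x v, fderiv ℝ F x v = v 0 • P x + v 1 • R x := by
  let θ : (Fin 2 → ℝ) → (Fin 2 → ℝ) →L[ℝ] V := fun x ↦
    (ContinuousLinearMap.proj (R := ℝ) (φ := fun _ : Fin 2 ↦ ℝ) 0).smulRight (P x) +
    (ContinuousLinearMap.proj (R := ℝ) (φ := fun _ : Fin 2 ↦ ℝ) 1).smulRight (R x)
  have hθ : ContDiff ℝ ∞ θ := (contDiff_const.smulRight hP).add (contDiff_const.smulRight hR)
  have hθv : ∀ x v, θ x v = v 0 • P x + v 1 • R x := fun x v ↦ rfl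
  have hdθ : ∀ x u v, fderiv ℝ θ x u v = v 0 • fderiv ℝ P x u + v 1 • fderiv ℝ R x u := by
    intro x u v
    have h1 : fderiv ℝ (fun y ↦ θ y v) x u = fderiv ℝ θ x u v := by
      rw [fderiv_clm_apply (hθ.differentiable (by simp) x) (differentiableAt_const _)]
      simp
    rw [← h1]
    simp only [hθv]
    have hPd := hP.differentiable (by simp) x
    have hRd := hR.differentiable (by simp) x
    have := ((hPd.hasFDerivAt.const_smul (v 0)).add (hRd.hasFDerivAt.const_smul (v 1))).fderiv
    exact congrArg (fun L ↦ L u) this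
  have hdec : ∀ (L : (Fin 2 → ℝ) →L[ℝ] V) (u : Fin 2 → ℝ),
      L u = u 0 • L (Pi.single 0 1) + u 1 • L (Pi.single 1 1) := by
    intro L u
    rw [← map_smul, ← map_smul, ← map_add]
    congr 1
    ext i; fin_cases i <;> simp
  obtain ⟨F, hF⟩ := convex_univ.exists_forall_hasFDerivAt_of_fderiv_symmetric isOpen_univ
    (hθ.differentiable (by simp)).differentiableOn (fun x _ u v ↦ by
      rw [hdθ, hdθ, hdec (fderiv ℝ P x) u, hdec (fderiv ℝ R x) u, hdec (fderiv ℝ P x) v,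
        hdec (fderiv ℝ R x) v, hcl]
      module)
  have hF' : fderiv ℝ F = θ := funext fun x ↦ (hF x trivial).fderiv
  refine ⟨F, ?_, fun x v ↦ by rw [hF', hθv]⟩
  rw [contDiff_infty_iff_fderiv, hF']
  exact ⟨fun x ↦ (hF x trivial).differentiableAt, hθ⟩

theorem fderiv_exp_mul {φ a b : (Fin 2 → ℝ) → ℝ} (hφ : ContDiff ℝ ∞ φ) (ha : ContDiff ℝ ∞ a)
    (hb : ContDiff ℝ ∞ b) (i : Fin 2) (x : Fin 2 → ℝ) :
    fderiv ℝ (fun y ↦ Complex.exp (-(φ y : ℂ) * Complex.I) * ((a y : ℂ) + b y * Complex.I)) x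
      (Pi.single i 1) = Complex.exp (-(φ x : ℂ) * Complex.I) *
      ((partialD i a x + partialD i b x * Complex.I) -
        partialD i φ x * Complex.I * (a x + b x * Complex.I)) := by
  have hd : ∀ {h : (Fin 2 → ℝ) → ℝ}, ContDiff ℝ ∞ h →
      HasFDerivAt (fun y ↦ (h y : ℂ)) (Complex.ofRealCLM.comp (fderiv ℝ h x)) x := fun hh ↦
    Complex.ofRealCLM.hasFDerivAt.comp x (differentiableAt_of_contDiff hh x).hasFDerivAt
  have h := (((hd hφ).neg.mul_const Complex.I).cexp.mul
    ((hd ha).add ((hd hb).mul_const Complex.I))).fderiv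
  refine (congrArg (fun L ↦ L (Pi.single i 1)) h).trans ?_
  simp [partialD]
  ring

theorem contDiff_exp_mul {φ a b : (Fin 2 → ℝ) → ℝ} (hφ : ContDiff ℝ ∞ φ) (ha : ContDiff ℝ ∞ a)
    (hb : ContDiff ℝ ∞ b) : ContDiff ℝ ∞ fun y ↦
      Complex.exp (-(φ y : ℂ) * Complex.I) * ((a y : ℂ) + b y * Complex.I) := by
  have hd : ∀ {h : (Fin 2 → ℝ) → ℝ}, ContDiff ℝ ∞ h → ContDiff ℝ ∞ fun y ↦ (h y : ℂ) :=
    fun hh ↦ Complex.ofRealCLM.contDiff.comp hh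
  exact ((hd hφ).neg.mul contDiff_const).cexp.mul ((hd ha).add ((hd hb).mul contDiff_const))

/-- A continuous doubly periodic function attains its maximum. -/
theorem DoublyPeriodic.exists_forall_le {h : (Fin 2 → ℝ) → ℝ} (hper : DoublyPeriodic h)
    (hc : Continuous h) : ∃ x, ∀ y, h y ≤ h x := by
  obtain ⟨x, -, hx⟩ := (isCompact_univ_pi fun _ : Fin 2 ↦ isCompact_Icc (a := (0 : ℝ)) (b := 1)
    ).exists_isMaxOn ⟨0, fun _ _ ↦ by simp⟩ hc.continuousOn
  refine ⟨x, fun y ↦ ?_⟩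
  obtain ⟨n, hn, -⟩ := existsUnique_add_mem_unitCell y
  rw [← hper y n]
  exact hx fun i _ ↦ Ioc_subset_Icc_self (hn i trivial)

namespace Metric

variable {g : Metric}

theorem doublyPeriodic_coframeE (g : Metric) : DoublyPeriodic g.coframeE :=
  doublyPeriodic_comp_proj fun p ↦ √(g.gram p 0 0)

theorem doublyPeriodic_coframeF (g : Metric) : DoublyPeriodic g.coframeF :=
  doublyPeriodic_comp_proj fun p ↦ g.gram p 0 1 / √(g.gram p 0 0)

theorem doublyPeriodic_coframeD (g : Metric) : DoublyPeriodic g.coframeD :=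
  doublyPeriodic_comp_proj fun p ↦ √(g.gram p).det / √(g.gram p 0 0)

theorem doublyPeriodic_connA (g : Metric) : DoublyPeriodic g.connA := fun x n ↦ by
  simp only [connA, doublyPeriodic_partialD g.doublyPeriodic_coframeE 1 x n,
    doublyPeriodic_partialD g.doublyPeriodic_coframeF 0 x n, g.doublyPeriodic_coframeD x n]

theorem doublyPeriodic_connB (g : Metric) : DoublyPeriodic g.connB := fun x n ↦ by
  simp only [connB, doublyPeriodic_partialD g.doublyPeriodic_coframeD 0 x n,
    g.doublyPeriodic_connA x n, g.doublyPeriodic_coframeE x n, g.doublyPeriodic_coframeF x n]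

/-- `F : ℝ² → ℂ` is a developing map of `g`: a local isometry, whose differential is the coframe of
`g` rotated by the angle `-φ`. -/
structure IsDeveloping (g : Metric) (φ : (Fin 2 → ℝ) → ℝ) (F : (Fin 2 → ℝ) → ℂ) : Prop where
  contDiff : ContDiff ℝ ∞ F
  fderiv_eq : ∀ x v, fderiv ℝ F x v = Complex.exp (-(φ x : ℂ) * Complex.I) *
    ((g.coframeE x * v 0 + g.coframeF x * v 1 : ℝ) + (g.coframeD x * v 1 : ℝ) * Complex.I)

/-- A flat metric has a developing map: the connection form is closed, hence the differential of an
angle `φ`, and the coframe rotated by `-φ` is closed. The angle changes by constants under the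
translations by `ℤ²`. -/
theorem exists_isDeveloping (hg : g.IsFlat) : ∃ φ F, g.IsDeveloping φ F ∧
    ∀ n : Fin 2 → ℤ, ∃ ρ, ∀ x, φ (x + fun i ↦ (n i : ℝ)) = φ x + ρ := by
  have hA := g.contDiff_connA
  have hB := g.contDiff_connB
  obtain ⟨φ, hφ, hφ'⟩ := exists_potential hA hB (fun x ↦ by
    have := g.gaussCurvature_mul_sqrt_det x
    rw [hg, zero_mul] at this
    exact sub_eq_zero.1 this.symm)
  have hφ0 : ∀ x, partialD 0 φ x = g.connA x := fun x ↦ by simp [partialD, hφ']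
  have hφ1 : ∀ x, partialD 1 φ x = g.connB x := fun x ↦ by simp [partialD, hφ']
  have he := g.contDiff_coframeE
  have hf := g.contDiff_coframeF
  have hd := g.contDiff_coframeD
  obtain ⟨F, hF, hF'⟩ := exists_potential (V := ℂ)
    (contDiff_exp_mul hφ he (contDiff_const (c := (0 : ℝ)))) (contDiff_exp_mul hφ hf hd) (fun x ↦ by
      rw [fderiv_exp_mul hφ hf hd, fderiv_exp_mul hφ he contDiff_const, hφ0, hφ1]
      congr 1
      have h0 := (g.coframeE_pos x).ne'
      have h1 := (g.coframeD_pos x).ne'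
      have hz : partialD 1 (fun _ ↦ (0 : ℝ)) x = 0 := by simp [partialD]
      have e1 : g.connA x * g.coframeD x = partialD 1 g.coframeE x - partialD 0 g.coframeF x :=
        div_mul_cancel₀ _ h1
      have e2 : g.connB x * g.coframeE x = g.connA x * g.coframeF x - partialD 0 g.coframeD x :=
        div_mul_cancel₀ _ h0
      apply Complex.ext
      · simp [hz]; linarith
      · simp [hz]; linarith)
  refine ⟨φ, F, ⟨hF, fun x v ↦ ?_⟩, fun n ↦ ?_⟩
  · rw [hF']
    simp only [Complex.real_smul]
    push_cast
    ring
  · refine ⟨φ (0 + fun i ↦ (n i : ℝ)) - φ 0, fun x ↦ ?_⟩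
    have hd : Differentiable ℝ φ := hφ.differentiable (by simp)
    have := is_const_of_fderiv_eq_zero (𝕜 := ℝ)
      (f := fun x ↦ φ (x + fun i ↦ (n i : ℝ)) - φ x) (by fun_prop) (fun x ↦ by
        rw [fderiv_fun_sub (by fun_prop) (hd x), fderiv_comp_add_right]
        ext v
        simp [hφ', g.doublyPeriodic_connA x n, g.doublyPeriodic_connB x n]) x 0
    linarith

namespace IsDeveloping

variable {φ : (Fin 2 → ℝ) → ℝ} {F : (Fin 2 → ℝ) → ℂ}

theorem surjective_fderiv (h : g.IsDeveloping φ F) (x : Fin 2 → ℝ) :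
    Function.Surjective (fderiv ℝ F x) := by
  intro z
  set w := Complex.exp ((φ x : ℂ) * Complex.I) * z with hw
  have he := (g.coframeE_pos x).ne'
  have hd := (g.coframeD_pos x).ne'
  refine ⟨![(w.re - g.coframeF x * (w.im / g.coframeD x)) / g.coframeE x, w.im / g.coframeD x], ?_⟩
  rw [h.fderiv_eq]
  simp only [Matrix.cons_val_zero, Matrix.cons_val_one]
  rw [mul_div_cancel₀ _ he, mul_div_cancel₀ _ hd, sub_add_cancel, Complex.re_add_im, hw,
    ← mul_assoc, ← Complex.exp_add]
  simp

theorem map_nhds (h : g.IsDeveloping φ F) (x : Fin 2 → ℝ) :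
    Filter.map F (nhds x) = nhds (F x) :=
  (h.contDiff.contDiffAt.hasStrictFDerivAt (by simp)).map_nhds_eq_of_surj
    (LinearMap.range_eq_top.2 (h.surjective_fderiv x))

/-- A developing map is open, so a function `m` without local maxima cannot be doubly periodic along
it. -/
theorem exists_ne (h : g.IsDeveloping φ F) {m : ℂ → ℝ} (hm : Continuous m)
    (hmax : ∀ z, ¬ IsLocalMax m z) :
    ∃ x, ∃ n : Fin 2 → ℤ, m (F (x + fun i ↦ (n i : ℝ))) ≠ m (F x) := by
  by_contra! hcon
  obtain ⟨x, hx⟩ := DoublyPeriodic.exists_forall_le (h := fun x ↦ m (F x)) hcon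
    (hm.comp h.contDiff.continuous)
  apply hmax (F x)
  rw [IsLocalMax, IsMaxFilter, ← h.map_nhds x, Filter.eventually_map]
  exact .of_forall hx

theorem not_isLocalMax_of_linear {m : ℂ →ₗ[ℝ] ℝ} (hm : m ≠ 0) (z : ℂ) : ¬ IsLocalMax m z := by
  intro hz
  obtain ⟨v, hv⟩ : ∃ v, 0 < m v := by
    obtain ⟨v, hv⟩ := DFunLike.ne_iff.1 hm
    rcases lt_or_gt_of_ne hv with h | h
    · exact ⟨-v, by simpa using h⟩
    · exact ⟨v, h⟩
  have ht : Filter.Tendsto (fun t : ℝ ↦ z + (t : ℂ) * v) (nhdsWithin 0 (Ioi 0)) (nhds z) := by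
    have : ContinuousAt (fun t : ℝ ↦ z + (t : ℂ) * v) 0 := by fun_prop
    have h2 := this.tendsto
    simp only [Complex.ofReal_zero, zero_mul, add_zero] at h2
    exact h2.mono_left nhdsWithin_le_nhds
  obtain ⟨t, ht1, ht2⟩ := ((ht.eventually hz).and self_mem_nhdsWithin).exists
  rw [← Complex.real_smul, map_add, map_smul, smul_eq_mul] at ht1
  have : 0 < t * m v := mul_pos ht2 hv
  linarith

theorem not_isLocalMax_dist (z₀ z : ℂ) : ¬ IsLocalMax (fun w ↦ dist w z₀) z := by
  intro hz
  have : Metric.closedBall z₀ (dist z z₀) ∈ nhds z := hz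
  rw [← mem_interior_iff_mem_nhds, interior_closedBall'] at this
  exact lt_irrefl _ (Metric.mem_ball.1 this)

/-- The holonomy of a flat metric on the torus consists of translations, which span a lattice: a
developing map is equivariant with respect to commuting isometries of `ℂ`. If one of them were not a
translation, they would have a common fixed point, and the distance of the developing map from it
would be doubly periodic; if the translations did not span `ℂ` over `ℝ`, some linear function would
be doubly periodic along the developing map. -/
theorem exists_translations (h : g.IsDeveloping φ F)
    (hφ : ∀ n : Fin 2 → ℤ, ∃ ρ, ∀ x, φ (x + fun i ↦ (n i : ℝ)) = φ x + ρ) :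
    ∃ b : (Fin 2 → ℤ) →+ ℂ, (∀ (n : Fin 2 → ℤ) x, F (x + fun i ↦ (n i : ℝ)) = F x + b n) ∧
      ∀ m : ℂ →ₗ[ℝ] ℝ, (∀ n, m (b n) = 0) → m = 0 := by
  choose ρ hρ using hφ
  let c : (Fin 2 → ℤ) → ℂ := fun n ↦ Complex.exp (-(ρ n : ℂ) * Complex.I)
  let b : (Fin 2 → ℤ) → ℂ := fun n ↦ F (0 + fun i ↦ (n i : ℝ)) - c n * F 0
  have hd : Differentiable ℝ F := h.contDiff.differentiable (by simp)
  have hF : ∀ (n : Fin 2 → ℤ) x, F (x + fun i ↦ (n i : ℝ)) = c n * F x + b n := by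
    intro n x
    have := is_const_of_fderiv_eq_zero (𝕜 := ℝ)
      (f := fun x ↦ F (x + fun i ↦ (n i : ℝ)) - c n * F x) (by fun_prop) (fun x ↦ by
        rw [fderiv_fun_sub (by fun_prop) (by fun_prop), fderiv_comp_add_right,
          fderiv_const_mul (hd x)]
        ext v
        simp only [_root_.sub_apply, _root_.smul_apply, h.fderiv_eq,
          hρ, g.doublyPeriodic_coframeE x n, g.doublyPeriodic_coframeF x n,
          g.doublyPeriodic_coframeD x n, smul_eq_mul, c, _root_.zero_apply]
        rw [← mul_assoc, ← Complex.exp_add, sub_eq_zero]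
        congr 2
        push_cast
        ring) x 0
    simp only [b]
    linear_combination this
  have hcnorm : ∀ n, ‖c n‖ = 1 := fun n ↦ by
    simp only [c]
    rw [← Complex.ofReal_neg]
    exact Complex.norm_exp_ofReal_mul_I _
  have hsum : ∀ n m : Fin 2 → ℤ, ∀ x : Fin 2 → ℝ, (x + fun i ↦ (((n + m) i : ℤ) : ℝ)) =
      (x + fun i ↦ (m i : ℝ)) + fun i ↦ (n i : ℝ) := fun n m x ↦ by
    ext i; simp; ring
  have hcomm : ∀ n m, c n * b m + b n = c m * b n + b m := by
    intro n m
    have h1 := congrArg F (hsum n m 0)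
    have h2 := congrArg F (hsum m n 0)
    rw [hF, hF] at h1 h2
    rw [add_comm m n] at h2
    linear_combination h2 - h1
  have hc1 : ∀ n, c n = 1 := by
    intro n
    by_contra hn
    have hn' : 1 - c n ≠ 0 := sub_ne_zero.2 (Ne.symm hn)
    obtain ⟨x, m, hxm⟩ := h.exists_ne (m := fun w ↦ dist w (b n / (1 - c n))) (by fun_prop)
      (not_isLocalMax_dist _)
    apply hxm
    have hfix : c m * F x + b m - b n / (1 - c n) = c m * (F x - b n / (1 - c n)) := by
      field_simp
      linear_combination -hcomm n m
    rw [hF, Complex.dist_eq, Complex.dist_eq, hfix, norm_mul, hcnorm, one_mul]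
  simp only [hc1, one_mul] at hF
  refine ⟨AddMonoidHom.mk' b fun n m ↦ ?_, hF, fun m hm ↦ ?_⟩
  · have h1 := congrArg F (hsum n m 0)
    rw [hF, hF, hF] at h1
    linear_combination h1
  · by_contra hm0
    obtain ⟨x, n, hxn⟩ := h.exists_ne (m := m) (LinearMap.continuous_of_finiteDimensional m)
      (not_isLocalMax_of_linear hm0)
    apply hxn
    rw [hF, map_add, show m (b n) = 0 from hm n, add_zero]

end IsDeveloping

end Metric

/-! ### Flat coordinates on the plane -/

section GlobalInverse

variable {Ψ : (Fin 2 → ℝ) → (Fin 2 → ℝ)} {N : (Fin 2 → ℤ) ≃+ (Fin 2 → ℤ)}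

theorem isCompact_preimage_of_equivariant (hΨ : Continuous Ψ)
    (hN : ∀ x (n : Fin 2 → ℤ), Ψ (x + fun i ↦ (n i : ℝ)) = Ψ x + fun i ↦ (N n i : ℝ))
    {K : Set (Fin 2 → ℝ)} (hK : IsCompact K) : IsCompact (Ψ ⁻¹' K) := by
  have hcube : IsCompact (Set.pi univ fun _ : Fin 2 ↦ Icc (0 : ℝ) 1) :=
    isCompact_univ_pi fun _ ↦ isCompact_Icc
  obtain ⟨R, hR⟩ := hK.isBounded.exists_norm_le
  obtain ⟨B, hB⟩ := hcube.exists_bound_of_continuousOn hΨ.continuousOn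
  have hfin : {n : Fin 2 → ℤ | ‖N n‖ ≤ B + R}.Finite := by
    have : (Metric.closedBall (0 : Fin 2 → ℤ) (B + R)).Finite :=
      (isCompact_closedBall _ _).finite_of_discrete
    refine (this.preimage (f := N) N.injective.injOn).subset fun n hn ↦ ?_
    simpa using hn
  refine Metric.isCompact_of_isClosed_isBounded (hK.isClosed.preimage hΨ) ?_
  have hb : Bornology.IsBounded (⋃ n ∈ {n : Fin 2 → ℤ | ‖N n‖ ≤ B + R},
      (fun x : Fin 2 → ℝ ↦ x - fun i ↦ (n i : ℝ)) '' (Set.pi univ fun _ ↦ Icc (0 : ℝ) 1)) :=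
    (Bornology.isBounded_biUnion hfin).2 fun n _ ↦
      (hcube.image (continuous_id.sub continuous_const)).isBounded
  refine hb.subset fun x hx ↦ ?_
  obtain ⟨n, hn, -⟩ := existsUnique_add_mem_unitCell x
  have hn' : (x + fun i ↦ (n i : ℝ)) ∈ Set.pi univ fun _ : Fin 2 ↦ Icc (0 : ℝ) 1 :=
    fun i hi ↦ Ioc_subset_Icc_self (hn i hi)
  refine mem_biUnion (x := n) ?_ ⟨_, hn', by simp⟩
  have h1 := hB _ hn'
  have h2 := hR _ hx
  have h3 : (fun i ↦ (N n i : ℝ)) = Ψ (x + fun i ↦ (n i : ℝ)) - Ψ x := by rw [hN]; simp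
  have h4 : ‖N n‖ = ‖fun i ↦ (N n i : ℝ)‖ := by
    simp only [Pi.norm_def]
    congr 1
  change ‖N n‖ ≤ B + R
  rw [h4, h3]
  exact (norm_sub_le _ _).trans (add_le_add h1 h2)

/-- A local diffeomorphism of the plane that is equivariant under an automorphism of `ℤ²` is proper,
hence a covering of the simply connected plane, hence a diffeomorphism. -/
theorem exists_homeomorph_of_equivariant (hΨ : ContDiff ℝ ∞ Ψ)
    (hN : ∀ x (n : Fin 2 → ℤ), Ψ (x + fun i ↦ (n i : ℝ)) = Ψ x + fun i ↦ (N n i : ℝ))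
    (hsurj : ∀ x, Function.Surjective (fderiv ℝ Ψ x)) :
    ∃ Φ : (Fin 2 → ℝ) ≃ₜ (Fin 2 → ℝ), ⇑Φ = Ψ ∧ ContDiff ℝ ∞ Φ.symm := by
  have hc := hΨ.continuous
  let E : (x : Fin 2 → ℝ) → (Fin 2 → ℝ) ≃L[ℝ] (Fin 2 → ℝ) := fun x ↦
    (LinearEquiv.ofBijective (fderiv ℝ Ψ x : (Fin 2 → ℝ) →ₗ[ℝ] (Fin 2 → ℝ))
      ⟨LinearMap.injective_iff_surjective.2 (hsurj x), hsurj x⟩).toContinuousLinearEquiv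
  have hE : ∀ x, (E x : (Fin 2 → ℝ) →L[ℝ] (Fin 2 → ℝ)) = fderiv ℝ Ψ x := fun x ↦ by ext; rfl
  have hloc : IsLocalHomeomorph Ψ := IsLocalHomeomorph.mk _ fun x ↦ by
    have h : HasStrictFDerivAt Ψ (E x : (Fin 2 → ℝ) →L[ℝ] (Fin 2 → ℝ)) x := by
      rw [hE]
      exact hΨ.contDiffAt.hasStrictFDerivAt (by simp)
    exact ⟨h.toOpenPartialHomeomorph Ψ, h.mem_toOpenPartialHomeomorph_source, fun _ _ ↦ rfl⟩
  have hproper : IsProperMap Ψ := isProperMap_iff_isCompact_preimage.2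
    ⟨hc, fun _ hK ↦ isCompact_preimage_of_equivariant hc hN hK⟩
  have hcov : IsCoveringMapOn Ψ univ := by
    refine hproper.isClosedMap.isCoveringMapOn_of_isLocalHomeomorphOn (fun x _ ↦ ?_)
      hloc.isLocalHomeomorphOn
    exact (isCompact_preimage_of_equivariant hc hN isCompact_singleton).finite
      (.of_openPartialHomeomorph Ψ subset_rfl fun e _ ↦
        (hloc e).imp fun _ h ↦ ⟨h.1, h.2.symm⟩)
  obtain ⟨G, ⟨hG0, hG⟩, -⟩ := hcov.existsUnique_continuousMap_lifts
    (ContinuousMap.id (Fin 2 → ℝ)) (a₀ := Ψ 0) (e₀ := 0) rfl (fun _ ↦ trivial)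
  replace hG : ∀ y, Ψ (G y) = y := fun y ↦ congrFun hG y
  have hcov' := isCoveringMap_iff_isCoveringMapOn_univ.2 hcov
  have hGΨ : (G ∘ Ψ) = id := hcov'.eq_of_comp_eq (G.continuous.comp hc) continuous_id
    (funext fun x ↦ hG (Ψ x)) 0 hG0
  let Φ : (Fin 2 → ℝ) ≃ₜ (Fin 2 → ℝ) :=
    ⟨⟨Ψ, G, fun x ↦ congrFun hGΨ x, hG⟩, hc, G.continuous⟩
  refine ⟨Φ, rfl, Φ.contDiff_symm (f₀' := E) (fun x ↦ ?_) hΨ⟩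
  rw [hE]
  exact (hΨ.differentiable (by simp) x).hasFDerivAt

end GlobalInverse

/-- The Jacobian matrix of a map of the plane. -/
def jacobian (Φ : (Fin 2 → ℝ) → (Fin 2 → ℝ)) (x : Fin 2 → ℝ) : Matrix (Fin 2) (Fin 2) ℝ :=
  .of fun i j ↦ fderiv ℝ Φ x (Pi.single j 1) i

theorem det_fderiv_eq (Φ : (Fin 2 → ℝ) → (Fin 2 → ℝ)) (x : Fin 2 → ℝ) :
    (fderiv ℝ Φ x).det = (jacobian Φ x).det := by
  rw [ContinuousLinearMap.det, ← LinearMap.det_toMatrix']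
  congr 1

/-- Global coordinates on the universal covering in which the flat metric `g` has the constant Gram
matrix `gramMatrix`, and in which the deck transformation of displacement `n` is the translation by
`N n`. -/
structure FlatChart (g : Metric) (N : (Fin 2 → ℤ) ≃+ (Fin 2 → ℤ)) where
  toHomeomorph : (Fin 2 → ℝ) ≃ₜ (Fin 2 → ℝ)
  gramMatrix : Matrix (Fin 2) (Fin 2) ℝ
  contDiff : ContDiff ℝ ∞ toHomeomorph
  contDiff_symm : ContDiff ℝ ∞ toHomeomorph.symm
  map_add : ∀ x (n : Fin 2 → ℤ),
    toHomeomorph (x + fun i ↦ (n i : ℝ)) = toHomeomorph x + fun i ↦ (N n i : ℝ)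
  gram_eq : ∀ x, g.gram (proj x) =
    (jacobian toHomeomorph x)ᵀ * gramMatrix * jacobian toHomeomorph x
  gramMatrix_symm : gramMatrix 1 0 = gramMatrix 0 1
  gramMatrix_pos : 0 < gramMatrix 0 0
  det_pos : 0 < gramMatrix.det

/-- A flat metric on the torus is isometric to the quotient of the Euclidean plane by a lattice. -/
theorem Metric.IsFlat.exists_flatChart {g : Metric} (hg : g.IsFlat)
    (N : (Fin 2 → ℤ) ≃+ (Fin 2 → ℤ)) : Nonempty (FlatChart g N) := by
  obtain ⟨φ, F, hF, hφ⟩ := Metric.exists_isDeveloping hg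
  obtain ⟨b, hb, hspan⟩ := hF.exists_translations hφ
  let β : Fin 2 → ℂ := fun j ↦ b (N.symm (Pi.single j 1))
  let A₀ : (Fin 2 → ℝ) →ₗ[ℝ] ℂ := Fintype.linearCombination ℝ β
  have hA₀ : ∀ v, A₀ v = v 0 • β 0 + v 1 • β 1 := fun v ↦ by
    simp [A₀, Fintype.linearCombination_apply, Fin.sum_univ_two]
  have hA₀N : ∀ n : Fin 2 → ℤ, A₀ (fun i ↦ (N n i : ℝ)) = b n := by
    intro n
    have h1 : n = N n 0 • N.symm (Pi.single 0 1) + N n 1 • N.symm (Pi.single 1 1) := by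
      rw [← map_zsmul, ← map_zsmul, ← map_add, AddEquiv.eq_symm_apply]
      ext i; fin_cases i <;> simp
    rw [hA₀]
    conv_rhs => rw [h1]
    rw [map_add, map_zsmul, map_zsmul]
    simp only [Complex.real_smul, zsmul_eq_mul, Complex.ofReal_intCast]
    rfl
  have hsurj : Function.Surjective A₀ := by
    rw [← LinearMap.range_eq_top]
    by_contra hne
    obtain ⟨m, hm, hle⟩ := Submodule.exists_le_ker_of_lt_top _ (lt_top_iff_ne_top.2 hne)
    exact hm (hspan m fun n ↦ hle ⟨_, hA₀N n⟩)
  have hinj : Function.Injective A₀ := (LinearMap.injective_iff_surjective_of_finrank_eq_finrank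
    (by simp [Complex.finrank_real_complex])).2 hsurj
  let A : (Fin 2 → ℝ) ≃L[ℝ] ℂ := (LinearEquiv.ofBijective A₀ ⟨hinj, hsurj⟩).toContinuousLinearEquiv
  have hA : ∀ v, A v = v 0 • β 0 + v 1 • β 1 := hA₀
  let Ψ : (Fin 2 → ℝ) → (Fin 2 → ℝ) := fun x ↦ A.symm (F x)
  have hΨ : ContDiff ℝ ∞ Ψ := A.symm.contDiff.comp hF.contDiff
  have hΨ' : ∀ x v, A (fderiv ℝ Ψ x v) = fderiv ℝ F x v := by
    intro x v
    have : fderiv ℝ Ψ x = (A.symm : ℂ →L[ℝ] (Fin 2 → ℝ)).comp (fderiv ℝ F x) :=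
      A.symm.comp_fderiv
    rw [this]
    simp
  have hΨN : ∀ x (n : Fin 2 → ℤ), Ψ (x + fun i ↦ (n i : ℝ)) = Ψ x + fun i ↦ (N n i : ℝ) := by
    intro x n
    apply A.injective
    simp only [Ψ, hb, map_add, ContinuousLinearEquiv.apply_symm_apply]
    rw [← hA₀N n]
    rfl
  have hΨs : ∀ x, Function.Surjective (fderiv ℝ Ψ x) := by
    intro x w
    obtain ⟨v, hv⟩ := hF.surjective_fderiv x (A w)
    exact ⟨v, A.injective ((hΨ' x v).trans hv)⟩
  obtain ⟨Φ, rfl', hΦs⟩ := exists_homeomorph_of_equivariant hΨ hΨN hΨs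
  let Q : Matrix (Fin 2) (Fin 2) ℝ := .of fun i j ↦ (β i).re * (β j).re + (β i).im * (β j).im
  have hgram : ∀ x, g.gram (proj x) = (jacobian Φ x)ᵀ * Q * jacobian Φ x := by
    intro x
    obtain ⟨u, hun, hu⟩ : ∃ u : ℂ, u.re * u.re + u.im * u.im = 1 ∧ ∀ v, fderiv ℝ F x v =
        u * ((g.coframeE x * v 0 + g.coframeF x * v 1 : ℝ) +
          (g.coframeD x * v 1 : ℝ) * Complex.I) := by
      refine ⟨_, ?_, hF.fderiv_eq x⟩
      rw [← Complex.normSq_apply, Complex.normSq_eq_norm_sq, ← Complex.ofReal_neg,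
        Complex.norm_exp_ofReal_mul_I, one_pow]
    have hJ : ∀ j, (jacobian Φ x 0 j : ℂ) * β 0 + (jacobian Φ x 1 j : ℂ) * β 1 =
        fderiv ℝ F x (Pi.single j 1) := by
      intro j
      rw [← hΨ', hA, rfl']
      rfl
    have h0 := hJ 0
    have h1 := hJ 1
    rw [hu] at h0 h1
    have h0r := congrArg Complex.re h0
    have h0i := congrArg Complex.im h0
    have h1r := congrArg Complex.re h1
    have h1i := congrArg Complex.im h1
    simp at h0r h0i h1r h1i
    ext i j
    simp only [Matrix.mul_apply, Fin.sum_univ_two, Matrix.transpose_apply, Q, Matrix.of_apply]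
    have key : ∀ i j : Fin 2, ((jacobian Φ x 0 i * (β 0).re + jacobian Φ x 1 i * (β 1).re) *
        (jacobian Φ x 0 j * (β 0).re + jacobian Φ x 1 j * (β 1).re) +
        (jacobian Φ x 0 i * (β 0).im + jacobian Φ x 1 i * (β 1).im) *
        (jacobian Φ x 0 j * (β 0).im + jacobian Φ x 1 j * (β 1).im)) = g.gram (proj x) i j := by
      rw [Fin.forall_fin_two, Fin.forall_fin_two, Fin.forall_fin_two, h0r, h0i, h1r, h1i,
        g.gram_symm, g.gram_zero_zero_eq, g.gram_zero_one_eq, g.gram_one_one_eq]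
      refine ⟨⟨?_, ?_⟩, ?_, ?_⟩
      · linear_combination (g.coframeE x * g.coframeE x) * hun
      · linear_combination (g.coframeE x * g.coframeF x) * hun
      · linear_combination (g.coframeE x * g.coframeF x) * hun
      · linear_combination (g.coframeF x * g.coframeF x + g.coframeD x * g.coframeD x) * hun
    rw [← key]
    ring
  have hdet : 0 < Q.det := by
    have h1 := congrArg Matrix.det (hgram 0)
    rw [det_mul, det_mul, det_transpose] at h1
    have h2 := g.det_gram_pos (proj 0)
    rw [h1] at h2
    by_contra! hle
    nlinarith [sq_nonneg (jacobian Φ 0).det]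
  refine ⟨⟨Φ, Q, by rw [rfl']; exact hΨ, hΦs, by rw [rfl']; exact hΨN, hgram, ?_, ?_, hdet⟩⟩
  · simp [Q, mul_comm]
  · have h0 : β 0 ≠ 0 := by
      intro h0
      rw [det_fin_two] at hdet
      simp [Q, h0] at hdet
    have := Complex.normSq_pos.2 h0
    rwa [Complex.normSq_apply] at this

/-! ### Conformal change of a flat metric -/

theorem doublyPeriodic_fderiv {h : (Fin 2 → ℝ) → ℝ} (hper : DoublyPeriodic h) :
    DoublyPeriodic (fderiv ℝ h) := by
  intro x n
  have : (fun y ↦ h (y + fun i ↦ (n i : ℝ))) = h := funext fun y ↦ hper y n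
  rw [← fderiv_comp_add_right, this]

namespace Metric

variable {g₀ g : Metric} {u : Torus → ℝ}

/-- The metric `g` is `e^{2u} g₀`. -/
def IsConformal (g₀ g : Metric) (u : Torus → ℝ) : Prop :=
  ∀ p, g.gram p = Real.exp (2 * u p) • g₀.gram p

theorem IsConformal.contDiff (h : IsConformal g₀ g u) : ContDiff ℝ ∞ fun x ↦ u (proj x) := by
  have : (fun x ↦ u (proj x)) = fun x ↦
      Real.log (g.gram (proj x) 0 0 / g₀.gram (proj x) 0 0) / 2 := by
    funext x
    rw [h, Matrix.smul_apply, smul_eq_mul, mul_div_cancel_right₀ _ (g₀.gram_zero_zero_pos _).ne',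
      Real.log_exp]
    ring
  rw [this]
  exact (((g.smooth 0 0).div (g₀.smooth 0 0) fun x ↦ (g₀.gram_zero_zero_pos _).ne').log
    fun x ↦ (div_pos (g.gram_zero_zero_pos _) (g₀.gram_zero_zero_pos _)).ne').div_const 2

theorem IsConformal.coframeE_eq (h : IsConformal g₀ g u) (x : Fin 2 → ℝ) :
    g.coframeE x = Real.exp (u (proj x)) * g₀.coframeE x := by
  rw [coframeE, h, Matrix.smul_apply, smul_eq_mul, Real.sqrt_mul (Real.exp_pos _).le,
    Real.sqrt_eq_rpow, ← Real.exp_mul]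
  congr 2
  ring

theorem IsConformal.coframeF_eq (h : IsConformal g₀ g u) (x : Fin 2 → ℝ) :
    g.coframeF x = Real.exp (u (proj x)) * g₀.coframeF x := by
  have h0 := (g₀.coframeE_pos x).ne'
  rw [coframeF, coframeF, h.coframeE_eq, h, Matrix.smul_apply, smul_eq_mul, two_mul, Real.exp_add]
  field_simp

theorem IsConformal.sqrt_det_eq (h : IsConformal g₀ g u) (x : Fin 2 → ℝ) :
    √(g.gram (proj x)).det = Real.exp (2 * u (proj x)) * √(g₀.gram (proj x)).det := by
  rw [h, Matrix.det_smul, Fintype.card_fin, Real.sqrt_mul (by positivity),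
    Real.sqrt_sq (Real.exp_pos _).le]

theorem IsConformal.coframeD_eq (h : IsConformal g₀ g u) (x : Fin 2 → ℝ) :
    g.coframeD x = Real.exp (u (proj x)) * g₀.coframeD x := by
  have h0 := (g₀.coframeE_pos x).ne'
  rw [coframeD, coframeD, h.coframeE_eq, h.sqrt_det_eq, two_mul, Real.exp_add]
  field_simp

/-- The component `√g₀ (∇u)⁰` of the gradient flux of `u` with respect to `g₀`. -/
def flux₀ (g₀ : Metric) (u : Torus → ℝ) (x : Fin 2 → ℝ) : ℝ :=
  (partialD 0 (fun x ↦ u (proj x)) x *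
      (g₀.coframeF x * g₀.coframeF x + g₀.coframeD x * g₀.coframeD x)
    - partialD 1 (fun x ↦ u (proj x)) x * (g₀.coframeE x * g₀.coframeF x)) /
    (g₀.coframeE x * g₀.coframeD x)

/-- The component `√g₀ (∇u)¹` of the gradient flux of `u` with respect to `g₀`. -/
def flux₁ (g₀ : Metric) (u : Torus → ℝ) (x : Fin 2 → ℝ) : ℝ :=
  (partialD 1 (fun x ↦ u (proj x)) x * g₀.coframeE x -
    partialD 0 (fun x ↦ u (proj x)) x * g₀.coframeF x) / g₀.coframeD x

theorem contDiff_flux₀ (hu : ContDiff ℝ ∞ fun x ↦ u (proj x)) : ContDiff ℝ ∞ (flux₀ g₀ u) := by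
  have he := g₀.contDiff_coframeE
  have hf := g₀.contDiff_coframeF
  have hd := g₀.contDiff_coframeD
  exact (((contDiff_partialD hu 0).mul ((hf.mul hf).add (hd.mul hd))).sub
    ((contDiff_partialD hu 1).mul (he.mul hf))).div (he.mul hd)
    fun x ↦ (mul_pos (g₀.coframeE_pos x) (g₀.coframeD_pos x)).ne'

theorem contDiff_flux₁ (hu : ContDiff ℝ ∞ fun x ↦ u (proj x)) : ContDiff ℝ ∞ (flux₁ g₀ u) :=
  (((contDiff_partialD hu 1).mul g₀.contDiff_coframeE).sub
    ((contDiff_partialD hu 0).mul g₀.contDiff_coframeF)).div g₀.contDiff_coframeD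
    fun x ↦ (g₀.coframeD_pos x).ne'

theorem doublyPeriodic_flux₀ (g₀ : Metric) (u : Torus → ℝ) : DoublyPeriodic (flux₀ g₀ u) := by
  intro x n
  have hU := doublyPeriodic_comp_proj u
  simp only [flux₀, doublyPeriodic_partialD hU 0 x n, doublyPeriodic_partialD hU 1 x n,
    g₀.doublyPeriodic_coframeE x n, g₀.doublyPeriodic_coframeF x n, g₀.doublyPeriodic_coframeD x n]

theorem doublyPeriodic_flux₁ (g₀ : Metric) (u : Torus → ℝ) : DoublyPeriodic (flux₁ g₀ u) := by
  intro x n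
  have hU := doublyPeriodic_comp_proj u
  simp only [flux₁, doublyPeriodic_partialD hU 0 x n, doublyPeriodic_partialD hU 1 x n,
    g₀.doublyPeriodic_coframeE x n, g₀.doublyPeriodic_coframeF x n, g₀.doublyPeriodic_coframeD x n]

/-- `K_g dA_g = -Δ₀u dA₀` if `g = e^{2u} g₀` and `g₀` is flat. -/
theorem IsConformal.gaussCurvature_mul_sqrt_det (h : IsConformal g₀ g u) (hflat : g₀.IsFlat)
    (x : Fin 2 → ℝ) : g.gaussCurvature (proj x) * √(g.gram (proj x)).det =
      -(partialD 0 (flux₀ g₀ u) x + partialD 1 (flux₁ g₀ u) x) := by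
  have hu := h.contDiff
  have hu' := hu.exp
  have he := g₀.contDiff_coframeE
  have hf := g₀.contDiff_coframeF
  have hd := g₀.contDiff_coframeD
  have hexp : ∀ i y, partialD i (fun x ↦ Real.exp (u (proj x))) y =
      Real.exp (u (proj y)) * partialD i (fun x ↦ u (proj x)) y := by
    intro i y
    simp only [partialD]
    rw [fderiv_exp (differentiableAt_of_contDiff hu y)]
    rfl
  have hE : g.coframeE = fun y ↦ Real.exp (u (proj y)) * g₀.coframeE y := funext h.coframeE_eq
  have hF : g.coframeF = fun y ↦ Real.exp (u (proj y)) * g₀.coframeF y := funext h.coframeF_eq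
  have hD : g.coframeD = fun y ↦ Real.exp (u (proj y)) * g₀.coframeD y := funext h.coframeD_eq
  have hA : g.connA = fun y ↦ g₀.connA y + flux₁ g₀ u y := by
    funext y
    have h1 := (Real.exp_pos (u (proj y))).ne'
    have h2 := (g₀.coframeD_pos y).ne'
    rw [connA, hE, hF, hD, partialD_mul hu' he, partialD_mul hu' hf, hexp, hexp, connA]
    simp only [flux₁]
    field_simp
    ring
  have hB : g.connB = fun y ↦ g₀.connB y - flux₀ g₀ u y := by
    funext y
    have h1 := (Real.exp_pos (u (proj y))).ne'
    have h2 := (g₀.coframeD_pos y).ne'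
    have h3 := (g₀.coframeE_pos y).ne'
    rw [connB, hA, hE, hF, hD, partialD_mul hu' hd, hexp, connB]
    simp only [flux₀, flux₁]
    field_simp
    ring
  have h0 := g₀.gaussCurvature_mul_sqrt_det x
  rw [hflat, zero_mul] at h0
  rw [g.gaussCurvature_mul_sqrt_det, hA, hB, partialD_sub g₀.contDiff_connB (contDiff_flux₀ hu),
    partialD_add g₀.contDiff_connA (contDiff_flux₁ hu)]
  linarith

/-- The energy density `√g₀ |∇u|²` of `u`. -/
def energyDensity (g₀ : Metric) (u : Torus → ℝ) (x : Fin 2 → ℝ) : ℝ :=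
  partialD 0 (fun x ↦ u (proj x)) x * flux₀ g₀ u x +
    partialD 1 (fun x ↦ u (proj x)) x * flux₁ g₀ u x

theorem continuous_energyDensity (hu : ContDiff ℝ ∞ fun x ↦ u (proj x)) :
    Continuous (energyDensity g₀ u) :=
  ((contDiff_partialD hu 0).continuous.mul (contDiff_flux₀ hu).continuous).add
    ((contDiff_partialD hu 1).continuous.mul (contDiff_flux₁ hu).continuous)

theorem energyDensity_eq (g₀ : Metric) (u : Torus → ℝ) (x : Fin 2 → ℝ) :
    energyDensity g₀ u x * √(g₀.gram (proj x)).det =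
      partialD 0 (fun x ↦ u (proj x)) x ^ 2 * g₀.gram (proj x) 1 1
      - 2 * partialD 0 (fun x ↦ u (proj x)) x * partialD 1 (fun x ↦ u (proj x)) x *
        g₀.gram (proj x) 0 1 + partialD 1 (fun x ↦ u (proj x)) x ^ 2 * g₀.gram (proj x) 0 0 := by
  have h2 := (g₀.coframeD_pos x).ne'
  have h3 := (g₀.coframeE_pos x).ne'
  rw [g₀.sqrt_det_eq, g₀.gram_zero_zero_eq, g₀.gram_zero_one_eq, g₀.gram_one_one_eq, energyDensity,
    flux₀, flux₁]
  field_simp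
  ring

theorem IsConformal.continuous_gaussCurvature_mul (h : IsConformal g₀ g u) (hflat : g₀.IsFlat) :
    Continuous fun x ↦ g.gaussCurvature (proj x) * √(g.gram (proj x)).det := by
  simp only [h.gaussCurvature_mul_sqrt_det hflat]
  exact ((contDiff_partialD (contDiff_flux₀ h.contDiff) 0).continuous.add
    (contDiff_partialD (contDiff_flux₁ h.contDiff) 1).continuous).neg

/-- Integration by parts: the energy of `u` weighted by `χ' ∘ u` is at most half the oscillation of
`χ` times the total absolute curvature of `g`. -/
theorem IsConformal.squareIntegral_energyDensity_le (h : IsConformal g₀ g u) (hflat : g₀.IsFlat)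
    {χ ψ : ℝ → ℝ} (hχ : ∀ s, HasDerivAt χ (ψ s) s) (hψ : Continuous ψ) {δ : ℝ}
    (hosc : ∀ s, |χ s - δ / 2| ≤ δ / 2) :
    squareIntegral (fun x ↦ ψ (u (proj x)) * energyDensity g₀ u x) ≤
      δ / 2 * squareIntegral fun x ↦ |g.gaussCurvature (proj x) * √(g.gram (proj x)).det| := by
  have hu := h.contDiff
  have hK := h.continuous_gaussCurvature_mul hflat
  have hE := continuous_energyDensity (g₀ := g₀) hu
  have hχC : ContDiff ℝ 1 χ := by
    rw [contDiff_one_iff_deriv]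
    exact ⟨fun s ↦ (hχ s).differentiableAt, by rwa [funext fun s ↦ (hχ s).deriv]⟩
  have hχc := hχC.continuous
  let w : (Fin 2 → ℝ) → ℝ := fun x ↦ χ (u (proj x)) - δ / 2
  have hw : ContDiff ℝ 1 w := (hχC.comp (hu.of_le (by simp))).sub contDiff_const
  have hwp : ∀ i x, fderiv ℝ w x (Pi.single i 1) =
      ψ (u (proj x)) * partialD i (fun x ↦ u (proj x)) x := by
    intro i x
    have := ((hχ (u (proj x))).comp_hasFDerivAt x
      (differentiableAt_of_contDiff hu x).hasFDerivAt).sub_const (δ / 2)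
    refine (congrArg (fun L ↦ L (Pi.single i 1)) this.fderiv).trans ?_
    simp [partialD]
  have hwper : DoublyPeriodic w := doublyPeriodic_comp_proj fun p ↦ χ (u p) - δ / 2
  -- The divergence of `w` times the flux integrates to zero.
  have hdiv : ∀ (i : Fin 2) {v : (Fin 2 → ℝ) → ℝ}, ContDiff ℝ ∞ v → DoublyPeriodic v →
      squareIntegral (fun x ↦ ψ (u (proj x)) * partialD i (fun x ↦ u (proj x)) x * v x +
        w x * partialD i v x) = 0 := by
    intro i v hv hvper
    have := squareIntegral_fderiv_eq_zero (h := fun x ↦ w x * v x) (hw.mul (hv.of_le (by simp)))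
      (fun x n ↦ by simp only [hwper x n, hvper x n]) i
    rw [← this]
    congr 1
    funext x
    rw [fderiv_fun_mul (hw.differentiable one_ne_zero x) (differentiableAt_of_contDiff hv x)]
    simp only [_root_.add_apply, _root_.smul_apply, smul_eq_mul, hwp]
    simp only [partialD]
    ring
  have h0 := hdiv 0 (contDiff_flux₀ hu) (doublyPeriodic_flux₀ g₀ u)
  have h1 := hdiv 1 (contDiff_flux₁ hu) (doublyPeriodic_flux₁ g₀ u)
  have hp := fun i ↦ (contDiff_partialD hu i).continuous
  have huc := hu.continuous
  have hwc := hw.continuous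
  have hf0 := (contDiff_flux₀ (g₀ := g₀) hu).continuous
  have hf1 := (contDiff_flux₁ (g₀ := g₀) hu).continuous
  have hf0' := (contDiff_partialD (contDiff_flux₀ (g₀ := g₀) hu) 0).continuous
  have hf1' := (contDiff_partialD (contDiff_flux₁ (g₀ := g₀) hu) 1).continuous
  have hψu : Continuous fun x ↦ ψ (u (proj x)) := hψ.comp huc
  have hp0 := hp 0
  have hp1 := hp 1
  have hsum : squareIntegral (fun x ↦ ψ (u (proj x)) * energyDensity g₀ u x) =
      squareIntegral fun x ↦ w x * (g.gaussCurvature (proj x) * √(g.gram (proj x)).det) := by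
    have h2 : squareIntegral (fun x ↦ ψ (u (proj x)) * energyDensity g₀ u x + (-1) *
        (w x * (g.gaussCurvature (proj x) * √(g.gram (proj x)).det))) = 0 := by
      have h3 := squareIntegral_add (((hψu.mul hp0).mul hf0).add (hwc.mul hf0'))
        (((hψu.mul hp1).mul hf1).add (hwc.mul hf1'))
      refine Eq.trans ?_ (h3.trans ((congrArg₂ (· + ·) h0 h1).trans (add_zero 0)))
      congr 1
      funext x
      simp only [h.gaussCurvature_mul_sqrt_det hflat, energyDensity, Pi.add_apply, Pi.mul_apply]
      ring
    have hψE : Continuous fun x ↦ ψ (u (proj x)) * energyDensity g₀ u x := hψu.mul hE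
    rw [squareIntegral_add hψE (by fun_prop), squareIntegral_const_mul] at h2
    linarith
  rw [hsum, ← squareIntegral_const_mul]
  refine squareIntegral_mono (by fun_prop) (by fun_prop) fun x ↦ (le_abs_self _).trans ?_
  rw [abs_mul]
  exact mul_le_mul_of_nonneg_right (hosc _) (abs_nonneg _)

end Metric

/-! ### The curvature bound for the oscillation -/

/-- A `C¹` approximation `χ` of the truncation of `s ↦ s - v₁` to values in `[0, v₂ - v₁]`. -/
theorem exists_cutoff {v₁ v₂ : ℝ} (hv : v₁ < v₂) {ε : ℝ} (hε : 0 < ε) :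
    ∃ (χ ψ : ℝ → ℝ) (δ : ℝ), (∀ s, HasDerivAt χ (ψ s) s) ∧ Continuous ψ ∧
      (∀ s, 0 ≤ ψ s ∧ ψ s ≤ 1) ∧ (∀ s ≤ v₁, χ s = 0) ∧ (∀ s, v₂ ≤ s → χ s = δ) ∧
      (∀ s, 0 ≤ χ s ∧ χ s ≤ δ) ∧ 0 < δ ∧ v₂ - v₁ - ε ≤ δ := by
  set η : ℝ := min (ε / 2) ((v₂ - v₁) / 4) with hη
  have hη0 : 0 < η := lt_min (by linarith) (by linarith)
  have hη1 : η ≤ ε / 2 := min_le_left _ _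
  have hη2 : η ≤ (v₂ - v₁) / 4 := min_le_right _ _
  -- A trapezoid on `[v₁, v₂]`, equal to `1` at distance at least `η` from the endpoints.
  let ψ : ℝ → ℝ := fun s ↦ min 1 (max 0 (min (s - v₁) (v₂ - s)) / η)
  have hψ : Continuous ψ := by fun_prop
  have hψ0 : ∀ s, 0 ≤ ψ s := fun s ↦ le_min zero_le_one (div_nonneg (le_max_left _ _) hη0.le)
  have hψ1 : ∀ s, ψ s ≤ 1 := fun s ↦ min_le_left _ _
  have hψv1 : ∀ s ≤ v₁, ψ s = 0 := fun s hs ↦ by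
    have : max 0 (min (s - v₁) (v₂ - s)) = 0 := max_eq_left ((min_le_left _ _).trans (by linarith))
    simp [ψ, this]
  have hψv2 : ∀ s, v₂ ≤ s → ψ s = 0 := fun s hs ↦ by
    have : max 0 (min (s - v₁) (v₂ - s)) = 0 := max_eq_left ((min_le_right _ _).trans (by linarith))
    simp [ψ, this]
  have hint : ∀ a b, IntervalIntegrable ψ volume a b := fun a b ↦ hψ.intervalIntegrable a b
  let χ : ℝ → ℝ := fun s ↦ ∫ t in v₁..s, ψ t
  have hχ : ∀ s, HasDerivAt χ (ψ s) s := fun s ↦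
    intervalIntegral.integral_hasDerivAt_right (hint _ _)
      (hψ.stronglyMeasurableAtFilter _ _) hψ.continuousAt
  have hmono : Monotone χ := monotone_of_deriv_nonneg (fun s ↦ (hχ s).differentiableAt)
    fun s ↦ by rw [(hχ s).deriv]; exact hψ0 s
  have hlow : ∀ s ≤ v₁, χ s = 0 := fun s hs ↦ by
    refine intervalIntegral.integral_zero_ae (.of_forall fun t ht ↦ hψv1 t ?_)
    rw [uIoc_of_ge hs] at ht
    exact ht.2
  have hhigh : ∀ s, v₂ ≤ s → χ s = χ v₂ := fun s hs ↦ by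
    have h1 : ∫ t in v₂..s, ψ t = 0 := by
      refine intervalIntegral.integral_zero_ae (.of_forall fun t ht ↦ hψv2 t ?_)
      rw [uIoc_of_le hs] at ht
      exact ht.1.le
    have h2 := intervalIntegral.integral_add_adjacent_intervals (hint v₁ v₂) (hint v₂ s)
    rw [h1, add_zero] at h2
    exact h2.symm
  have hδ : v₂ - v₁ - 2 * η ≤ χ v₂ := by
    have h1 : ∫ t in (v₁ + η)..(v₂ - η), ψ t = v₂ - v₁ - 2 * η := by
      rw [intervalIntegral.integral_congr (g := fun _ ↦ 1)]
      · simp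
        ring
      · intro t ht
        rw [uIcc_of_le (by linarith)] at ht
        refine min_eq_left ?_
        rw [le_div_iff₀ hη0, one_mul]
        exact le_max_of_le_right (le_min (by linarith [ht.1]) (by linarith [ht.2]))
    rw [← h1]
    exact intervalIntegral.integral_mono_interval (by linarith) (by linarith) (by linarith)
      (.of_forall hψ0) (hint _ _)
  refine ⟨χ, ψ, χ v₂, hχ, hψ, fun s ↦ ⟨hψ0 s, hψ1 s⟩, hlow, hhigh, fun s ↦ ⟨?_, ?_⟩, by linarith,
    by linarith⟩
  · rcases le_total s v₁ with h | h
    · exact (hlow s h).ge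
    · exact (hlow v₁ le_rfl).ge.trans (hmono h)
  · rcases le_total s v₂ with h | h
    · exact hmono h
    · exact (hhigh s h).le

namespace FlatChart

variable {g₀ g : Metric} {N : (Fin 2 → ℤ) ≃+ (Fin 2 → ℤ)} (T : FlatChart g₀ N)

theorem symm_add (y : Fin 2 → ℝ) (n : Fin 2 → ℤ) :
    T.toHomeomorph.symm (y + fun i ↦ (n i : ℝ)) =
      T.toHomeomorph.symm y + fun i ↦ (N.symm n i : ℝ) := by
  apply T.toHomeomorph.injective
  rw [T.map_add]
  simp

/-- A function on the torus, read in the flat coordinates. -/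
def pull {α : Type*} (h : Torus → α) (y : Fin 2 → ℝ) : α := h (proj (T.toHomeomorph.symm y))

theorem doublyPeriodic_pull {α : Type*} (h : Torus → α) : DoublyPeriodic (T.pull h) := fun y n ↦ by
  rw [pull, T.symm_add, proj_add_intCast, pull]

theorem pull_apply {α : Type*} (h : Torus → α) (x : Fin 2 → ℝ) :
    T.pull h (T.toHomeomorph x) = h (proj x) := by
  rw [pull, Homeomorph.symm_apply_apply]

theorem contDiff_pull {h : Torus → ℝ} (hh : ContDiff ℝ ∞ fun x ↦ h (proj x)) :
    ContDiff ℝ ∞ (T.pull h) :=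
  hh.comp T.contDiff_symm

theorem det_gram_eq (x : Fin 2 → ℝ) :
    (g₀.gram (proj x)).det = (jacobian T.toHomeomorph x).det ^ 2 * T.gramMatrix.det := by
  rw [T.gram_eq, det_mul, det_mul, det_transpose]
  ring

theorem sqrt_det_gram_eq (x : Fin 2 → ℝ) : √(g₀.gram (proj x)).det =
    √T.gramMatrix.det * |(fderiv ℝ T.toHomeomorph x).det| := by
  rw [T.det_gram_eq, Real.sqrt_mul (sq_nonneg _), Real.sqrt_sq_eq_abs, det_fderiv_eq, mul_comm]

theorem abs_det_pos (x : Fin 2 → ℝ) : 0 < |(fderiv ℝ T.toHomeomorph x).det| := by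
  have h := Real.sqrt_pos.2 (g₀.det_gram_pos (proj x))
  rw [T.sqrt_det_gram_eq] at h
  exact pos_of_mul_pos_right h (Real.sqrt_nonneg _)

theorem squareIntegral_mul_sqrt_det {h : Torus → ℝ} (hh : Continuous fun x ↦ h (proj x)) :
    squareIntegral (fun x ↦ h (proj x) * √(g₀.gram (proj x)).det) =
      √T.gramMatrix.det * squareIntegral (T.pull h) := by
  have hc : Continuous (T.pull h) := hh.comp T.toHomeomorph.symm.continuous
  rw [← squareIntegral_comp_mul_abs_det T.toHomeomorph (T.contDiff.of_le (by simp)) N.toEquiv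
    T.map_add hc (T.doublyPeriodic_pull h), ← squareIntegral_const_mul]
  congr 1
  funext x
  rw [T.sqrt_det_gram_eq, T.pull_apply]
  ring

/-- The slope of the lines orthogonal to the first coordinate direction. -/
def slope : ℝ := T.gramMatrix 0 1 / T.gramMatrix 0 0

/-- Cauchy–Schwarz for the derivative in the direction `(-slope, 1)` orthogonal to the first
coordinate direction, whose squared length is `det / gramMatrix 0 0`. -/
theorem sq_fderiv_le_energyDensity {u : Torus → ℝ} (hu : ContDiff ℝ ∞ fun x ↦ u (proj x))
    (x : Fin 2 → ℝ) :
    T.gramMatrix 0 0 * (fderiv ℝ (T.pull u) (T.toHomeomorph x) ![-T.slope, 1] ^ 2 *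
      |(fderiv ℝ T.toHomeomorph x).det|) ≤ √T.gramMatrix.det * g₀.energyDensity u x := by
  set J := jacobian T.toHomeomorph x with hJ
  set Q := T.gramMatrix with hQ
  set L := fderiv ℝ (T.pull u) (T.toHomeomorph x) with hL
  set a₀ := L (Pi.single 0 1) with ha₀
  set a₁ := L (Pi.single 1 1) with ha₁
  have hLv : ∀ v : Fin 2 → ℝ, L v = v 0 * a₀ + v 1 * a₁ := by
    intro v
    rw [ha₀, ha₁, ← smul_eq_mul, ← smul_eq_mul, ← map_smul, ← map_smul, ← _root_.map_add]
    congr 1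
    ext i; fin_cases i <;> simp
  have hchain : ∀ j, partialD j (fun x ↦ u (proj x)) x = J 0 j * a₀ + J 1 j * a₁ := by
    intro j
    have h1 : (fun x ↦ u (proj x)) = T.pull u ∘ T.toHomeomorph :=
      funext fun x ↦ (T.pull_apply u x).symm
    rw [partialD, h1, fderiv_comp x ((T.contDiff_pull hu).differentiable (by simp) _)
      (T.contDiff.differentiable (by simp) _)]
    exact hLv _
  have hdet : |(fderiv ℝ T.toHomeomorph x).det| ^ 2 = (J 0 0 * J 1 1 - J 0 1 * J 1 0) ^ 2 := by
    rw [sq_abs, det_fderiv_eq, det_fin_two]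
  have hpos := T.abs_det_pos x
  set D := |(fderiv ℝ T.toHomeomorph x).det| with hD
  set q := √Q.det with hq
  have hq0 : 0 < q := Real.sqrt_pos.2 T.det_pos
  have hQ0 := T.gramMatrix_pos
  have hqq : q ^ 2 = Q 0 0 * Q 1 1 - Q 0 1 * Q 0 1 := by
    rw [hq, Real.sq_sqrt T.det_pos.le, ← hQ, det_fin_two, hQ, T.gramMatrix_symm]
  have hE := g₀.energyDensity_eq u x
  rw [T.sqrt_det_gram_eq, ← hQ, ← hq, ← hD, hchain, hchain, T.gram_eq] at hE
  simp only [← hJ, ← hQ, Matrix.mul_apply, Fin.sum_univ_two, Matrix.transpose_apply] at hE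
  rw [show Q 1 0 = Q 0 1 from T.gramMatrix_symm] at hE
  have hE' : g₀.energyDensity u x * q =
      D * (a₀ ^ 2 * Q 1 1 - 2 * a₀ * a₁ * Q 0 1 + a₁ ^ 2 * Q 0 0) := by
    refine mul_right_cancel₀ hpos.ne' ?_
    calc g₀.energyDensity u x * q * D = g₀.energyDensity u x * (q * D) := by ring
      _ = D ^ 2 * (a₀ ^ 2 * Q 1 1 - 2 * a₀ * a₁ * Q 0 1 + a₁ ^ 2 * Q 0 0) := by
        rw [hE, hdet]; ring
      _ = _ := by ring
  have hν : Q 0 0 * L ![-T.slope, 1] = a₁ * Q 0 0 - a₀ * Q 0 1 := by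
    rw [hLv, slope, ← hQ]
    simp only [Matrix.cons_val_zero, Matrix.cons_val_one]
    have : Q 0 0 ≠ 0 := hQ0.ne'
    field_simp
    ring
  have hsq : (Q 0 0 * L ![-T.slope, 1]) ^ 2 ≤
      Q 0 0 * (a₀ ^ 2 * Q 1 1 - 2 * a₀ * a₁ * Q 0 1 + a₁ ^ 2 * Q 0 0) := by
    rw [hν]
    have : 0 ≤ a₀ ^ 2 * q ^ 2 := by positivity
    rw [hqq] at this
    nlinarith
  have hsq' : Q 0 0 * L ![-T.slope, 1] ^ 2 ≤
      a₀ ^ 2 * Q 1 1 - 2 * a₀ * a₁ * Q 0 1 + a₁ ^ 2 * Q 0 0 := by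
    refine le_of_mul_le_mul_left (le_of_eq_of_le ?_ hsq) hQ0
    ring
  calc Q 0 0 * (L ![-T.slope, 1] ^ 2 * D) = D * (Q 0 0 * L ![-T.slope, 1] ^ 2) := by ring
    _ ≤ D * (a₀ ^ 2 * Q 1 1 - 2 * a₀ * a₁ * Q 0 1 + a₁ ^ 2 * Q 0 0) := by gcongr
    _ = _ := by rw [← hE']; ring

/-- The length–area argument: the energy of a truncation of `u` bounds from above, and by the
oscillation inequality and Cauchy–Schwarz from below. -/
theorem mul_le_of_cutoff {u : Torus → ℝ} (h : g₀.IsConformal g u) (hflat : g₀.IsFlat)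
    {Y Z : ℝ → Fin 2 → ℝ} (hY : Continuous Y) (hZ : Continuous Z) {k l : ℝ} (hk : k ≠ 0)
    (hl : l ≠ 0) (hYk : ∀ s, Y (s + 1) = Y s + ![k, 0]) (hZl : ∀ s, Z (s + 1) = Z s + ![l, 0])
    {χ ψ : ℝ → ℝ} {δ : ℝ} (hχ : ∀ s, HasDerivAt χ (ψ s) s) (hψ : Continuous ψ)
    (hψ01 : ∀ s, 0 ≤ ψ s ∧ ψ s ≤ 1) (hχδ : ∀ s, 0 ≤ χ s ∧ χ s ≤ δ) (hδ : 0 < δ)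
    (hχY : ∀ s, χ (T.pull u (Y s)) = 0) (hχZ : ∀ s, χ (T.pull u (Z s)) = δ) :
    8 * T.gramMatrix 0 0 * δ ≤ √T.gramMatrix.det *
      squareIntegral fun x ↦ |g.gaussCurvature (proj x) * √(g.gram (proj x)).det| := by
  have hu := h.contDiff
  set f := T.pull u with hf
  have hfC : ContDiff ℝ ∞ f := T.contDiff_pull hu
  have hfc := hfC.continuous
  have hχC : ContDiff ℝ 1 χ := by
    rw [contDiff_one_iff_deriv]
    exact ⟨fun s ↦ (hχ s).differentiableAt, by rwa [funext fun s ↦ (hχ s).deriv]⟩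
  set ν : Fin 2 → ℝ := ![-T.slope, 1] with hν
  have hw' : ∀ y, fderiv ℝ (fun y ↦ χ (f y)) y ν = ψ (f y) * fderiv ℝ f y ν := by
    intro y
    have := (hχ (f y)).comp_hasFDerivAt y (hfC.differentiable (by simp) y).hasFDerivAt
    exact congrArg (fun L ↦ L ν) this.fderiv
  have hdf : Continuous fun y ↦ fderiv ℝ f y ν := by
    have := hfC.continuous_fderiv (by simp)
    fun_prop
  have hψf : Continuous fun y ↦ ψ (f y) := hψ.comp hfc
  have hosc := two_mul_sub_le_squareIntegral (w := fun y ↦ χ (f y))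
    (hχC.comp (hfC.of_le (by simp))) (fun y n ↦ by
      simp only [hf, T.doublyPeriodic_pull u y n]) hY hZ hk hl hYk hZl
    (α := 0) (β := δ) (fun s ↦ (hχY s).le) (fun s ↦ (hχZ s).ge) T.slope
  simp only [← hν, hw'] at hosc
  -- Splitting `ψ = √ψ * √ψ` leaves the energy weighted by `ψ`, not by `ψ ^ 2`; the other factor
  -- is at most `1`.
  have hcs := squareIntegral_mul_sq_le (q := fun y ↦ √(ψ (f y)))
    (r := fun y ↦ √(ψ (f y)) * |fderiv ℝ f y ν|) (by fun_prop) (by fun_prop)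
  have e1 : (fun y ↦ √(ψ (f y)) * (√(ψ (f y)) * |fderiv ℝ f y ν|)) =
      fun y ↦ |ψ (f y) * fderiv ℝ f y ν| := by
    funext y
    rw [← mul_assoc, Real.mul_self_sqrt (hψ01 _).1, abs_mul, abs_of_nonneg (hψ01 _).1]
  have e2 : (fun y ↦ (√(ψ (f y)) * |fderiv ℝ f y ν|) ^ 2) =
      fun y ↦ ψ (f y) * fderiv ℝ f y ν ^ 2 := by
    funext y
    rw [mul_pow, Real.sq_sqrt (hψ01 _).1, sq_abs]
  have e3 : (fun y ↦ √(ψ (f y)) ^ 2) = fun y ↦ ψ (f y) :=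
    funext fun y ↦ Real.sq_sqrt (hψ01 _).1
  rw [e1, e2, e3] at hcs
  have hψle : squareIntegral (fun y ↦ ψ (f y)) ≤ 1 := by
    rw [← squareIntegral_const 1]
    exact squareIntegral_mono hψf continuous_const fun y ↦ (hψ01 _).2
  set I := squareIntegral fun y ↦ ψ (f y) * fderiv ℝ f y ν ^ 2 with hI
  have hI0 : 0 ≤ I := by
    rw [← squareIntegral_const 0]
    exact squareIntegral_mono continuous_const (by fun_prop)
      fun y ↦ mul_nonneg (hψ01 _).1 (sq_nonneg _)
  have h4 : 4 * δ ^ 2 ≤ I := by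
    have h1 : (2 * (δ - 0)) ^ 2 ≤ squareIntegral (fun y ↦ |ψ (f y) * fderiv ℝ f y ν|) ^ 2 :=
      pow_le_pow_left₀ (by linarith) hosc 2
    nlinarith
  have hE := h.squareIntegral_energyDensity_le hflat hχ hψ (δ := δ) (fun s ↦ by
    rw [abs_le]
    constructor <;> linarith [(hχδ s).1, (hχδ s).2])
  have hper : DoublyPeriodic fun y ↦ ψ (f y) * fderiv ℝ f y ν ^ 2 := fun y n ↦ by
    simp only [hf, T.doublyPeriodic_pull u y n,
      doublyPeriodic_fderiv (T.doublyPeriodic_pull u) y n]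
  have hchange := squareIntegral_comp_mul_abs_det T.toHomeomorph (T.contDiff.of_le (by simp))
    N.toEquiv T.map_add (by fun_prop) hper
  have hdetc : Continuous fun x ↦ (fderiv ℝ T.toHomeomorph x).det :=
    ContinuousLinearMap.continuous_det.comp (T.contDiff.continuous_fderiv (by simp))
  have hΦc := T.toHomeomorph.continuous
  have hEc : Continuous fun x ↦ ψ (u (proj x)) * g₀.energyDensity u x :=
    (hψ.comp hu.continuous).mul (Metric.continuous_energyDensity hu)
  have h5 : T.gramMatrix 0 0 * I ≤ √T.gramMatrix.det *
      squareIntegral (fun x ↦ ψ (u (proj x)) * g₀.energyDensity u x) := by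
    rw [hI, ← hchange, ← squareIntegral_const_mul, ← squareIntegral_const_mul]
    refine squareIntegral_mono ?_ (by fun_prop) fun x ↦ ?_
    · exact continuous_const.mul (((hψf.comp hΦc).mul ((hdf.comp hΦc).pow 2)).mul hdetc.abs)
    · have := mul_le_mul_of_nonneg_left (T.sq_fderiv_le_energyDensity hu x)
        (hψ01 (u (proj x))).1
      rw [hf, T.pull_apply]
      linarith
  have hQ0 := T.gramMatrix_pos
  have h6 : T.gramMatrix 0 0 * (4 * δ ^ 2) ≤ √T.gramMatrix.det * (δ / 2 * squareIntegral
      fun x ↦ |g.gaussCurvature (proj x) * √(g.gram (proj x)).det|) :=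
    (mul_le_mul_of_nonneg_left h4 hQ0.le).trans
      (h5.trans (mul_le_mul_of_nonneg_left hE (Real.sqrt_nonneg _)))
  refine le_of_mul_le_mul_right ?_ (half_pos hδ)
  linarith

/-- The curvature bound for the oscillation of `u`, in flat coordinates whose first axis is parallel
to the displacements of both curves. -/
theorem oscillation_le {u : Torus → ℝ} (h : g₀.IsConformal g u) (hflat : g₀.IsFlat)
    {Y Z : ℝ → Fin 2 → ℝ} (hY : Continuous Y) (hZ : Continuous Z) {k l : ℝ} (hk : k ≠ 0)
    (hl : l ≠ 0) (hYk : ∀ s, Y (s + 1) = Y s + ![k, 0]) (hZl : ∀ s, Z (s + 1) = Z s + ![l, 0])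
    {v₁ v₂ : ℝ} (hv : v₁ < v₂) (hv₁ : ∀ s, T.pull u (Y s) ≤ v₁) (hv₂ : ∀ s, v₂ ≤ T.pull u (Z s)) :
    8 * T.gramMatrix 0 0 * (v₂ - v₁) ≤ √T.gramMatrix.det *
      squareIntegral fun x ↦ |g.gaussCurvature (proj x) * √(g.gram (proj x)).det| := by
  have hQ0 := T.gramMatrix_pos
  have h8 : 0 < 8 * T.gramMatrix 0 0 := by positivity
  rw [← le_div_iff₀' h8]
  refine le_of_forall_pos_le_add fun ε hε ↦ ?_
  obtain ⟨χ, ψ, δ, hχ, hψ, hψ01, hlow, hhigh, hχδ, hδ, hδε⟩ := exists_cutoff hv hε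
  have := T.mul_le_of_cutoff h hflat hY hZ hk hl hYk hZl hχ hψ hψ01 hχδ hδ
    (fun s ↦ hlow _ (hv₁ s)) (fun s ↦ hhigh _ (hv₂ s))
  rw [← le_div_iff₀' h8] at this
  linarith

end FlatChart

/-! ### Area, total curvature and systole -/

theorem exists_isLift_of_add_one {γ : ℝ → Fin 2 → ℝ} (hγ : Continuous γ) {m : Fin 2 → ℤ}
    (hm : ∀ t, γ (t + 1) = γ t + fun i ↦ (m i : ℝ)) : ∃ c, IsLift c γ m := by
  have hper : Function.Periodic (fun t ↦ proj (γ t)) 1 := fun t ↦ by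
    simp only [hm, proj_add_intCast]
  exact ⟨⟨hper.lift, (QuotientAddGroup.isQuotientMap_mk _).continuous_iff.2
    (continuous_proj.comp hγ)⟩, hγ, fun t ↦ rfl, hm⟩

theorem jacobian_mulVec (Φ : (Fin 2 → ℝ) → (Fin 2 → ℝ)) (x v : Fin 2 → ℝ) :
    jacobian Φ x *ᵥ v = fderiv ℝ Φ x v := by
  have hv : v = v 0 • Pi.single 0 1 + v 1 • Pi.single 1 1 := by
    ext i; fin_cases i <;> simp
  conv_rhs => rw [hv, map_add, map_smul, map_smul]
  ext i
  simp only [Matrix.mulVec, dotProduct, Fin.sum_univ_two, jacobian, Matrix.of_apply, Pi.add_apply,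
    Pi.smul_apply, smul_eq_mul]
  ring

namespace Metric

variable (g : Metric)

theorem area_eq : g.area = squareIntegral fun x ↦ √(g.gram (proj x)).det := by
  simp only [area, areaIntegral, one_mul]
  exact integral_torus_eq_squareIntegral (h := fun p ↦ √(g.gram p).det)
    g.contDiff_sqrt_det.continuous

theorem area_nonneg : 0 ≤ g.area :=
  integral_nonneg fun _ ↦ by simp

theorem curvatureNorm_one : g.curvatureNorm 1 = ∫ p, |g.gaussCurvature p * √(g.gram p).det| := by
  simp [curvatureNorm, areaIntegral, abs_mul, abs_of_nonneg (Real.sqrt_nonneg _)]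

theorem curvatureNorm_one_nonneg : 0 ≤ g.curvatureNorm 1 := by
  rw [curvatureNorm_one]
  exact integral_nonneg fun _ ↦ abs_nonneg _

theorem IsConformal.curvatureNorm_one_eq {g₀ g : Metric} {u : Torus → ℝ} (h : g₀.IsConformal g u)
    (hflat : g₀.IsFlat) : g.curvatureNorm 1 =
      squareIntegral fun x ↦ |g.gaussCurvature (proj x) * √(g.gram (proj x)).det| := by
  rw [g.curvatureNorm_one]
  exact integral_torus_eq_squareIntegral (h := fun p ↦ |g.gaussCurvature p * √(g.gram p).det|)
    (h.continuous_gaussCurvature_mul hflat).abs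

theorem length_nonneg (γ : ℝ → Fin 2 → ℝ) : 0 ≤ g.length γ :=
  intervalIntegral.integral_nonneg zero_le_one fun _ _ ↦ Real.sqrt_nonneg _

theorem systole_le_length {c : C(UnitAddCircle, Torus)} {γ : ℝ → Fin 2 → ℝ} {m : Fin 2 → ℤ}
    (h : IsLift c γ m) (hm : m ≠ 0) (hγ : ContDiff ℝ 1 γ) : g.systole ≤ g.length γ := by
  refine csInf_le ⟨0, ?_⟩ ⟨c, γ, h.not_nullhomotopic hm, hγ, h.proj_eq, rfl⟩
  rintro _ ⟨_, γ, -, -, -, rfl⟩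
  exact g.length_nonneg γ

/-- By compactness of the torus, the norm of `g` dominates the coordinates of tangent vectors. -/
theorem exists_abs_le_mul_sqrt : ∃ C, 0 < C ∧ ∀ x v : Fin 2 → ℝ, ∀ i,
    |v i| ≤ C * √(v ⬝ᵥ (g.gram (proj x) *ᵥ v)) := by
  let S : (Fin 2 → ℝ) → ℝ := fun x ↦
    (g.gram (proj x) 0 0 + g.gram (proj x) 1 1) / (g.gram (proj x)).det
  have hS : Continuous S := ((g.smooth 0 0).continuous.add (g.smooth 1 1).continuous).div
    g.contDiff_det.continuous fun x ↦ (g.det_gram_pos _).ne'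
  obtain ⟨x₀, hx₀⟩ := DoublyPeriodic.exists_forall_le (h := S)
    (doublyPeriodic_comp_proj fun p ↦ (g.gram p 0 0 + g.gram p 1 1) / (g.gram p).det) hS
  have hS0 : ∀ x, 0 < S x := fun x ↦ div_pos
    (add_pos (g.posDef _).diag_pos (g.posDef _).diag_pos) (g.det_gram_pos _)
  refine ⟨√(S x₀), Real.sqrt_pos.2 (hS0 _), fun x v i ↦ ?_⟩
  rw [← Real.sqrt_mul (hS0 _).le]
  apply Real.abs_le_sqrt
  set G := g.gram (proj x) with hG
  have hG00 : 0 < G 0 0 := (g.posDef _).diag_pos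
  have hG11 : 0 < G 1 1 := (g.posDef _).diag_pos
  have hdet : 0 < G.det := g.det_gram_pos _
  have hsymm : G 1 0 = G 0 1 := g.gram_symm _
  have hquad : v ⬝ᵥ (G *ᵥ v) = G 0 0 * v 0 ^ 2 + 2 * G 0 1 * (v 0 * v 1) + G 1 1 * v 1 ^ 2 := by
    simp only [Matrix.mulVec, dotProduct, Fin.sum_univ_two, hsymm]
    ring
  have h0 : G.det * v 0 ^ 2 ≤ G 1 1 * (v ⬝ᵥ (G *ᵥ v)) := by
    rw [hquad, det_fin_two, hsymm]
    nlinarith [sq_nonneg (G 0 1 * v 0 + G 1 1 * v 1)]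
  have h1 : G.det * v 1 ^ 2 ≤ G 0 0 * (v ⬝ᵥ (G *ᵥ v)) := by
    rw [hquad, det_fin_two, hsymm]
    nlinarith [sq_nonneg (G 0 0 * v 0 + G 0 1 * v 1)]
  have hq : 0 ≤ v ⬝ᵥ (G *ᵥ v) :=
    nonneg_of_mul_nonneg_right ((mul_nonneg hdet.le (sq_nonneg _)).trans h0) hG11
  have h2 : G.det * v i ^ 2 ≤ (G 0 0 + G 1 1) * (v ⬝ᵥ (G *ᵥ v)) := by
    rw [add_mul]
    have a0 := mul_nonneg hG00.le hq
    have a1 := mul_nonneg hG11.le hq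
    fin_cases i
    · exact h0.trans (by linarith)
    · exact h1.trans (by linarith)
  refine le_trans ?_ (mul_le_mul_of_nonneg_right (hx₀ x) hq)
  change _ ≤ (G 0 0 + G 1 1) / G.det * _
  rw [div_mul_eq_mul_div, le_div_iff₀' hdet]
  exact h2

/-- A non-contractible loop has a nonzero integral displacement, so some coordinate of its lift
varies by at least `1`. -/
theorem systole_pos : 0 < g.systole := by
  obtain ⟨C, hC, hle⟩ := g.exists_abs_le_mul_sqrt
  refine (inv_pos.2 hC).trans_le (le_csInf ?_ ?_)
  · obtain ⟨c, hc⟩ := exists_isLift_of_add_one (γ := fun t _ ↦ t) (m := fun _ ↦ 1) (by fun_prop)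
      (fun t ↦ by ext i; simp)
    exact ⟨_, c, _, hc.not_nullhomotopic (fun h ↦ one_ne_zero (congrFun h 0)),
      contDiff_pi.2 fun _ ↦ contDiff_id, hc.proj_eq, rfl⟩
  · rintro _ ⟨c, γ, hc, hγ, hproj, rfl⟩
    obtain ⟨m, hm⟩ := isLift_of_proj_eq hγ.continuous hproj
    have hm0 : m ≠ 0 := by
      rintro rfl
      exact hc hm.nullhomotopic
    obtain ⟨i, hi⟩ : ∃ i, m i ≠ 0 := Function.ne_iff.1 hm0
    have hγ' : Continuous (deriv γ) := hγ.continuous_deriv le_rfl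
    have hγi : Continuous fun t ↦ deriv γ t i := (continuous_apply i).comp hγ'
    have hint : ∫ t in (0 : ℝ)..1, deriv γ t i = m i := by
      rw [intervalIntegral.integral_eq_sub_of_hasDerivAt (f := fun t ↦ γ t i) (fun t _ ↦
        hasDerivAt_pi.1 (hγ.differentiable one_ne_zero t).hasDerivAt i)
        (hγi.intervalIntegrable _ _)]
      have := congrFun (hm.add_one 0) i
      simp only [zero_add, Pi.add_apply] at this
      linarith
    have h1 : (1 : ℝ) ≤ |∫ t in (0 : ℝ)..1, deriv γ t i| := by
      rw [hint]
      exact_mod_cast Int.one_le_abs hi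
    have hgram : ∀ i j, Continuous fun t ↦ g.gram (proj (γ t)) i j := fun i j ↦
      (g.smooth i j).continuous.comp hγ.continuous
    have hspeed : Continuous fun t ↦ √(deriv γ t ⬝ᵥ (g.gram (proj (γ t)) *ᵥ deriv γ t)) := by
      simp only [Matrix.mulVec, dotProduct, Fin.sum_univ_two]
      fun_prop
    rw [inv_le_iff_one_le_mul₀' hC]
    refine h1.trans ((intervalIntegral.abs_integral_le_integral_abs zero_le_one).trans ?_)
    rw [length, ← intervalIntegral.integral_const_mul]
    exact intervalIntegral.integral_mono_on zero_le_one (hγi.abs.intervalIntegrable _ _)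
      ((continuous_const.mul hspeed).intervalIntegrable _ _) fun t _ ↦ hle _ _ i

end Metric

namespace FlatChart

variable {g₀ g : Metric} {N : (Fin 2 → ℤ) ≃+ (Fin 2 → ℤ)} (T : FlatChart g₀ N) {u : Torus → ℝ}

/-- In flat coordinates the lines parallel to the first axis have constant `g₀`-speed, so their
`g`-length only involves the conformal factor. -/
theorem length_line (h : g₀.IsConformal g u) (η : ℝ) :
    g.length (fun t ↦ T.toHomeomorph.symm ![t, η]) =
      √(T.gramMatrix 0 0) * ∫ t in (0 : ℝ)..1, Real.exp (T.pull u ![t, η]) := by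
  rw [Metric.length, ← intervalIntegral.integral_const_mul]
  congr 1
  funext t
  have hline : HasDerivAt (fun t : ℝ ↦ (![t, η] : Fin 2 → ℝ)) (Pi.single 0 1) t := by
    rw [hasDerivAt_pi]
    intro j
    fin_cases j
    · simpa using hasDerivAt_id' t
    · simpa using hasDerivAt_const t η
  set γ := fun t : ℝ ↦ T.toHomeomorph.symm ![t, η] with hγ
  have hγd : HasDerivAt γ (deriv γ t) t := DifferentiableAt.hasDerivAt
    ((T.contDiff_symm.differentiable (by simp) _).comp t hline.differentiableAt)
  have hJ : jacobian T.toHomeomorph (γ t) *ᵥ deriv γ t = Pi.single 0 1 := by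
    rw [jacobian_mulVec]
    have h1 := (T.contDiff.differentiable (by simp) (γ t)).hasFDerivAt.comp_hasDerivAt t hγd
    have h2 : ⇑T.toHomeomorph ∘ γ = fun t : ℝ ↦ ![t, η] :=
      funext fun t ↦ T.toHomeomorph.apply_symm_apply _
    rw [h2] at h1
    exact h1.unique hline
  have hquad : deriv γ t ⬝ᵥ (g.gram (proj (γ t)) *ᵥ deriv γ t) =
      Real.exp (T.pull u ![t, η]) ^ 2 * T.gramMatrix 0 0 := by
    rw [h, T.gram_eq, Matrix.smul_mulVec, dotProduct_smul, ← Matrix.mulVec_mulVec, hJ,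
      ← Matrix.mulVec_mulVec, Matrix.dotProduct_mulVec, ← Matrix.mulVec_transpose,
      Matrix.transpose_transpose, hJ, smul_eq_mul, ← Real.exp_nat_mul]
    simp [pull, hγ]
  rw [hquad, Real.sqrt_mul (sq_nonneg _), Real.sqrt_sq (Real.exp_pos _).le, mul_comm]

theorem systole_le (h : g₀.IsConformal g u) :
    g.systole ≤ √(T.gramMatrix 0 0) * squareIntegral fun y ↦ Real.exp (T.pull u y) := by
  have hf : Continuous (T.pull u) := (T.contDiff_pull h.contDiff).continuous
  have hexp : Continuous fun z : ℝ × ℝ ↦ Real.exp (T.pull u ![z.2, z.1]) :=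
    Real.continuous_exp.comp (hf.comp (continuous_vecCons₂ (by fun_prop) (by fun_prop)))
  have hline : ∀ η, g.systole ≤
      √(T.gramMatrix 0 0) * ∫ t in (0 : ℝ)..1, Real.exp (T.pull u ![t, η]) := by
    intro η
    rw [← T.length_line h]
    have hc : ContDiff ℝ ∞ fun t : ℝ ↦ (![t, η] : Fin 2 → ℝ) := by
      rw [contDiff_pi]
      intro i
      fin_cases i
      · exact contDiff_id
      · exact contDiff_const
    have hγ : ContDiff ℝ ∞ fun t : ℝ ↦ T.toHomeomorph.symm ![t, η] := T.contDiff_symm.comp hc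
    obtain ⟨c, hl⟩ := exists_isLift_of_add_one hγ.continuous (m := N.symm (Pi.single 0 1))
      (fun t ↦ by
        rw [← T.symm_add]
        congr 1
        ext i; fin_cases i <;> simp)
    exact g.systole_le_length hl (by simp) (hγ.of_le (by simp))
  calc g.systole = ∫ _ in (0 : ℝ)..1, g.systole := by simp
    _ ≤ ∫ η in (0 : ℝ)..1, √(T.gramMatrix 0 0) *
        ∫ t in (0 : ℝ)..1, Real.exp (T.pull u ![t, η]) := by
      refine intervalIntegral.integral_mono_on zero_le_one (by simp) ?_ fun η _ ↦ hline η
      refine Continuous.intervalIntegrable (continuous_const.mul ?_) _ _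
      exact intervalIntegral.continuous_parametric_intervalIntegral_of_continuous' hexp 0 1
    _ = _ := by rw [intervalIntegral.integral_const_mul, squareIntegral]

/-- The length–area inequality: the closed lines parallel to the first coordinate axis foliate the
torus. -/
theorem sq_systole_mul_le (h : g₀.IsConformal g u) :
    g.systole ^ 2 * √T.gramMatrix.det ≤ T.gramMatrix 0 0 * g.area := by
  have hu := h.contDiff.continuous
  have hf : Continuous (T.pull u) := (T.contDiff_pull h.contDiff).continuous
  have harea : g.area = √T.gramMatrix.det *
      squareIntegral fun y ↦ Real.exp (T.pull u y) ^ 2 := by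
    have h1 : (fun y ↦ Real.exp (T.pull u y) ^ 2) = T.pull fun p ↦ Real.exp (2 * u p) := by
      funext y
      simp only [pull]
      rw [← Real.exp_nat_mul]
      norm_num
    rw [h1, ← T.squareIntegral_mul_sqrt_det (Real.continuous_exp.comp (continuous_const.mul hu)),
      g.area_eq]
    simp only [h.sqrt_det_eq]
  have hcs := squareIntegral_mul_sq_le (q := fun _ ↦ 1) (r := fun y ↦ Real.exp (T.pull u y))
    continuous_const (by fun_prop)
  simp only [one_mul, one_pow, squareIntegral_const] at hcs
  have hsys := pow_le_pow_left₀ g.systole_pos.le (T.systole_le h) 2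
  rw [mul_pow, Real.sq_sqrt T.gramMatrix_pos.le] at hsys
  rw [harea, mul_left_comm, mul_comm]
  exact mul_le_mul_of_nonneg_left
    (hsys.trans (mul_le_mul_of_nonneg_left hcs T.gramMatrix_pos.le)) (Real.sqrt_nonneg _)

end FlatChart

/-! ### The estimate for two closed paths -/

/-- By Bézout, an automorphism of `ℤ²` takes a given vector to a multiple of the first basis
vector. -/
theorem exists_addEquiv_apply_one_eq_zero {m : Fin 2 → ℤ} (hm : m ≠ 0) :
    ∃ N : (Fin 2 → ℤ) ≃+ (Fin 2 → ℤ), N m 1 = 0 := by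
  have hg : ((m 0).gcd (m 1) : ℤ) ≠ 0 := by
    intro h
    obtain ⟨h0, h1⟩ := Int.gcd_eq_zero_iff.1 (Int.natCast_eq_zero.1 h)
    exact hm (by ext i; fin_cases i <;> simpa)
  have hbez := Int.gcd_eq_gcd_ab (m 0) (m 1)
  obtain ⟨a, ha⟩ := Int.gcd_dvd_left (a := m 0) (b := m 1)
  obtain ⟨b, hb⟩ := Int.gcd_dvd_right (a := m 0) (b := m 1)
  set d : ℤ := ((m 0).gcd (m 1) : ℤ)
  set x := Int.gcdA (m 0) (m 1)
  set y := Int.gcdB (m 0) (m 1)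
  have hone : a * x + b * y = 1 := by
    refine mul_left_cancel₀ hg ?_
    calc d * (a * x + b * y) = d * a * x + d * b * y := by ring
      _ = d * 1 := by rw [← ha, ← hb, ← hbez, mul_one]
  refine ⟨⟨⟨fun n ↦ ![x * n 0 + y * n 1, -b * n 0 + a * n 1],
    fun n ↦ ![a * n 0 - y * n 1, b * n 0 + x * n 1], fun n ↦ ?_, fun n ↦ ?_⟩, fun n n' ↦ ?_⟩, ?_⟩
  · ext i
    fin_cases i <;> simp
    · linear_combination n 0 * hone
    · linear_combination n 1 * hone
  · ext i
    fin_cases i <;> simp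
    · linear_combination n 0 * hone
    · linear_combination n 1 * hone
  · ext i
    fin_cases i <;> simp <;> ring
  · change -b * m 0 + a * m 1 = 0
    linear_combination (-b) * ha + a * hb

theorem IsLift.ne_zero {c : C(UnitAddCircle, Torus)} {γ : ℝ → Fin 2 → ℝ} {m : Fin 2 → ℤ}
    (h : IsLift c γ m) (hc : ¬ NullHomologous c) : m ≠ 0 := by
  rintro rfl
  exact hc (nullHomologous_of_nullhomotopic h.nullhomotopic)

/-- Two paths on which the values of `u` are separated do not meet, so their classes are
proportional, and flat coordinates can be adapted to both of them. -/
theorem exists_flatChart_oscillation_le {g₀ g : Metric} {u : Torus → ℝ} (h : g₀.IsConformal g u)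
    (hflat : g₀.IsFlat) {c₁ c₂ : C(UnitAddCircle, Torus)} (hc₁ : ¬ NullHomologous c₁)
    (hc₂ : ¬ NullHomologous c₂) {v₁ v₂ : ℝ} (hv : v₁ < v₂) (hv₁ : ∀ t, u (c₁ t) ≤ v₁)
    (hv₂ : ∀ t, v₂ ≤ u (c₂ t)) : ∃ (N : (Fin 2 → ℤ) ≃+ (Fin 2 → ℤ)) (T : FlatChart g₀ N),
      8 * T.gramMatrix 0 0 * (v₂ - v₁) ≤ √T.gramMatrix.det * g.curvatureNorm 1 := by
  obtain ⟨γ₁, m₁, h₁⟩ := exists_isLift c₁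
  obtain ⟨γ₂, m₂, h₂⟩ := exists_isLift c₂
  have hm₁ := h₁.ne_zero hc₁
  have hm₂ := h₂.ne_zero hc₂
  obtain ⟨N, hN⟩ := exists_addEquiv_apply_one_eq_zero hm₁
  obtain ⟨T⟩ := hflat.exists_flatChart N
  refine ⟨N, T, ?_⟩
  have hk : N m₁ 0 ≠ 0 := fun h0 ↦ hm₁ <| N.map_eq_zero_iff.1 <| by
    ext i; fin_cases i
    · exact h0
    · exact hN
  have hY : Continuous fun s ↦ T.toHomeomorph (γ₁ s) := T.toHomeomorph.continuous.comp h₁.continuous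
  have hZ : Continuous fun s ↦ T.toHomeomorph (γ₂ s) := T.toHomeomorph.continuous.comp h₂.continuous
  have hYN : ∀ s, T.toHomeomorph (γ₁ (s + 1)) = T.toHomeomorph (γ₁ s) + fun i ↦ (N m₁ i : ℝ) :=
    fun s ↦ by rw [h₁.add_one, T.map_add]
  have hZN : ∀ s, T.toHomeomorph (γ₂ (s + 1)) = T.toHomeomorph (γ₂ s) + fun i ↦ (N m₂ i : ℝ) :=
    fun s ↦ by rw [h₂.add_one, T.map_add]
  have hN₂ : N m₂ 1 = 0 := by
    by_contra hne
    obtain ⟨s, t, hst⟩ := exists_intersection_of_equivariant hY hZ hYN hZN (by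
      simp only [hN, Int.cast_zero, zero_mul, sub_zero]
      exact_mod_cast mul_ne_zero hk hne)
    have h3 := T.toHomeomorph.injective hst
    have h4 := hv₁ (s : UnitAddCircle)
    have h5 := hv₂ (t : UnitAddCircle)
    rw [← h₁.proj_eq, h3, h₂.proj_eq] at h4
    linarith
  have hl : N m₂ 0 ≠ 0 := fun h0 ↦ hm₂ <| N.map_eq_zero_iff.1 <| by
    ext i; fin_cases i
    · exact h0
    · exact hN₂
  have hvec : ∀ {n : Fin 2 → ℤ}, n 1 = 0 → (fun i ↦ (n i : ℝ)) = ![(n 0 : ℝ), 0] := by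
    intro n hn
    ext i; fin_cases i <;> simp [hn]
  rw [h.curvatureNorm_one_eq hflat]
  refine T.oscillation_le h hflat hY hZ (Int.cast_ne_zero.2 hk) (Int.cast_ne_zero.2 hl)
    (fun s ↦ by rw [hYN, hvec hN]) (fun s ↦ by rw [hZN, hvec hN₂]) hv (fun s ↦ ?_) fun s ↦ ?_
  · rw [T.pull_apply, h₁.proj_eq]
    exact hv₁ _
  · rw [T.pull_apply, h₂.proj_eq]
    exact hv₂ _

/-- The length–area inequality turns a bound in terms of the flat chart into one in terms of the
systolic volume of any metric conformal to `g₀`. -/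
theorem FlatChart.sub_le_of_oscillation_le {g₀ g : Metric} {N : (Fin 2 → ℤ) ≃+ (Fin 2 → ℤ)}
    (T : FlatChart g₀ N) {u : Torus → ℝ} (h : g₀.IsConformal g u) {δ K : ℝ} (hK : 0 ≤ K)
    (hT : 8 * T.gramMatrix 0 0 * δ ≤ √T.gramMatrix.det * K) :
    δ ≤ K * g.systolicVolume / 8 := by
  have hQ := T.gramMatrix_pos
  have hs : 0 < g.systole ^ 2 := pow_pos g.systole_pos 2
  rw [Metric.systolicVolume, ← mul_div_assoc, div_div, le_div_iff₀ (by positivity)]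
  refine le_of_mul_le_mul_left ?_ hQ
  calc T.gramMatrix 0 0 * (δ * (g.systole ^ 2 * 8))
      = g.systole ^ 2 * (8 * T.gramMatrix 0 0 * δ) := by ring
    _ ≤ g.systole ^ 2 * (√T.gramMatrix.det * K) := by gcongr
    _ = (g.systole ^ 2 * √T.gramMatrix.det) * K := by ring
    _ ≤ (T.gramMatrix 0 0 * g.area) * K := mul_le_mul_of_nonneg_right (T.sq_systole_mul_le h) hK
    _ = _ := by ring

end RiemannTorus

end

theorem mainTheorem9
    (g₀ g : RiemannTorus.Metric) (hflat : g₀.IsFlat)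
    (u : RiemannTorus.Torus → ℝ)
    (hg : ∀ p, g.gram p = Real.exp (2 * u p) • g₀.gram p)
    (c₁ c₂ : C(UnitAddCircle, RiemannTorus.Torus))
    (hc₁ : ¬ RiemannTorus.NullHomologous c₁) (hc₂ : ¬ RiemannTorus.NullHomologous c₂)
    (v₁ v₂ : ℝ)
    (hv₁ : IsGreatest (Set.range (fun t => u (c₁ t))) v₁)
    (hv₂ : IsLeast (Set.range (fun t => u (c₂ t))) v₂) :
    v₂ - v₁ ≤ g.curvatureNorm 1 * g₀.systolicVolume / 8 ∧
      v₂ - v₁ ≤ g.curvatureNorm 1 * g.systolicVolume / 8 := by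
  have hK := g.curvatureNorm_one_nonneg
  rcases le_or_gt v₂ v₁ with hv | hv
  · have hnonneg : ∀ k : RiemannTorus.Metric, 0 ≤ g.curvatureNorm 1 * k.systolicVolume / 8 :=
      fun k ↦ div_nonneg (mul_nonneg hK (div_nonneg k.area_nonneg (sq_nonneg _))) (by norm_num)
    exact ⟨(sub_nonpos.2 hv).trans (hnonneg g₀), (sub_nonpos.2 hv).trans (hnonneg g)⟩
  · obtain ⟨N, T, hT⟩ := RiemannTorus.exists_flatChart_oscillation_le hg hflat hc₁ hc₂ hv
      (fun t ↦ hv₁.2 ⟨t, rfl⟩) (fun t ↦ hv₂.2 ⟨t, rfl⟩)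
    have hid : g₀.IsConformal g₀ fun _ ↦ 0 := fun p ↦ by simp
    exact ⟨T.sub_le_of_oscillation_le hid hK hT, T.sub_le_of_oscillation_le hg hK hT⟩
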